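/- Let $\mathfrak g$ be a $5$-dimensional complex Lie algebra with a $3$-dimensional abelian ideal $\mathfrak a$. Let $(\mathfrak g;\mathfrak e,\mathfrak f)$ be an ILC triple, that is, $\mathfrak e,\mathfrak f\subset\mathfrak g$ are $2$-dimensional complex subalgebras with $\mathfrak e\cap\mathfrak f=0$ such that, for $C:=\mathfrak e\oplus\mathfrak f$, the skew form $\bigwedge^2 C\to\mathfrak g/C$, $x\wedge y\mapsto [x,y] \bmod C$, is non-degenerate. Let $\tau$ be an admissible anti-involution of it (so that the triple is anti-self-dual), that is, a conjugate-linear map $\tau:\mathfrak g\to\mathfrak g$ with $\tau[x,y]=[\tau x,\tau y]$ for all $x,y$, $\tau^2=\mathrm{id}$, $\tau(\mathfrak e)=\mathfrak f$ and $\tau(\mathfrak f)=\mathfrak e$. Let $G$ be any complex Lie group with Lie algebra $\mathfrak g$, and let $E,F\subset TG$ be the left-invariant holomorphic distributions determined by $\mathfrak e$ and $\mathfrak f$. The ILC symmetry dimension of $(\mathfrak g;\mathfrak e,\mathfrak f)$ is the complex dimension of the space of germs at the identity of $G$ of holomorphic vector fields $\xi$ that preserve both $E$ and $F$, i.e. such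 that $[\xi,Y]$ is a section of $E$ (respectively $F$) for every local holomorphic section $Y$ of $E$ (respectively $F$). If the ILC symmetry dimension of $(\mathfrak g;\mathfrak e,\mathfrak f)$ equals $5$, then $\tau(\mathfrak a)=\mathfrak a$ and $\mathfrak e\cap\mathfrak a=\mathfrak f\cap\mathfrak a=0$. -/

import Mathlib

open scoped Manifold ContDiff Topology

/-! ### Legendrian contact triples on a complex Lie algebra -/

section Algebra

variable {𝔤 : Type*} [LieRing 𝔤] [LieAlgebra ℂ 𝔤]

/-- `(𝔤; 𝔢, 𝔣)` is an ILC triple: `𝔤` has dimension five, `𝔢` and `𝔣` are two-dimensional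
subalgebras with `𝔢 ∩ 𝔣 = 0`, and for `C = 𝔢 ⊕ 𝔣` the skew form
`C × C → 𝔤 / C, (x, y) ↦ [x, y] mod C` is non-degenerate. -/
structure IsILCTriple (𝔢 𝔣 : LieSubalgebra ℂ 𝔤) : Prop where
  finrank_eq : Module.finrank ℂ 𝔤 = 5
  finrank_left : Module.finrank ℂ 𝔢 = 2
  finrank_right : Module.finrank ℂ 𝔣 = 2
  inf_eq_bot : 𝔢.toSubmodule ⊓ 𝔣.toSubmodule = ⊥
  nondegenerate : ∀ x ∈ 𝔢.toSubmodule ⊔ 𝔣.toSubmodule,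
    (∀ y ∈ 𝔢.toSubmodule ⊔ 𝔣.toSubmodule, ⁅x, y⁆ ∈ 𝔢.toSubmodule ⊔ 𝔣.toSubmodule) → x = 0

/-- The conjugate-linear map `τ` is an admissible anti-involution of `(𝔤; 𝔢, 𝔣)`: it preserves
brackets, squares to the identity, and swaps `𝔢` and `𝔣`. -/
structure IsAdmissibleAntiInvolution (𝔢 𝔣 : LieSubalgebra ℂ 𝔤)
    (τ : 𝔤 →ₛₗ[starRingEnd ℂ] 𝔤) : Prop where
  map_lie : ∀ x y : 𝔤, τ ⁅x, y⁆ = ⁅τ x, τ y⁆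
  involutive : Function.Involutive τ
  map_left : 𝔢.toSubmodule.map τ = 𝔣.toSubmodule
  map_right : 𝔣.toSubmodule.map τ = 𝔢.toSubmodule

end Algebra

/-! ### Infinitesimal symmetries of a pair of distributions on a complex manifold -/

section Manifold

variable {E : Type*} [NormedAddCommGroup E] [NormedSpace ℂ E]
  {M : Type*} [TopologicalSpace M] [ChartedSpace E M]

/-- The vector field `ξ` on the complex manifold `M` is holomorphic near the point `q`. -/
def HolomorphicVectorFieldAt [IsManifold 𝓘(ℂ, E) ω M]
    (ξ : Π x : M, TangentSpace 𝓘(ℂ, E) x) (q : M) : Prop :=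
  ContMDiffAt 𝓘(ℂ, E) 𝓘(ℂ, E).tangent ω
    (fun x => (⟨x, ξ x⟩ : TangentBundle 𝓘(ℂ, E) M)) q

/-- The Lie derivative along `ξ` maps local holomorphic sections of the distribution `D` around
`q` to vector fields whose value at `q` lies in `D`. -/
def PreservesDistributionAt [IsManifold 𝓘(ℂ, E) ω M]
    (D : Π x : M, Submodule ℂ (TangentSpace 𝓘(ℂ, E) x))
    (ξ : Π x : M, TangentSpace 𝓘(ℂ, E) x) (q : M) : Prop :=
  ∀ Y : Π x : M, TangentSpace 𝓘(ℂ, E) x, HolomorphicVectorFieldAt Y q →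
    (∀ᶠ x in 𝓝 q, Y x ∈ D x) → VectorField.mlieBracket 𝓘(ℂ, E) ξ Y q ∈ D q

/-- The vector fields that are, on some neighbourhood of `p`, holomorphic infinitesimal symmetries
of the pair of distributions `(D₁, D₂)`. No condition is imposed away from `p`. -/
def localSymmetries [CompleteSpace E] [IsManifold 𝓘(ℂ, E) ω M]
    (D₁ D₂ : Π x : M, Submodule ℂ (TangentSpace 𝓘(ℂ, E) x)) (p : M) :
    Submodule ℂ (Π x : M, TangentSpace 𝓘(ℂ, E) x) where
  carrier := {ξ | ∀ᶠ q in 𝓝 p, HolomorphicVectorFieldAt ξ q ∧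
    PreservesDistributionAt D₁ ξ q ∧ PreservesDistributionAt D₂ ξ q}
  add_mem' := by
    intro ξ ζ hξ hζ
    filter_upwards [hξ, hζ] with q hq hq'
    have hd := hq.1.mdifferentiableAt (by simp)
    have hd' := hq'.1.mdifferentiableAt (by simp)
    refine ⟨hq.1.add_section hq'.1, fun Y hY hYD => ?_, fun Y hY hYD => ?_⟩
    · rw [VectorField.mlieBracket_add_left hd hd']
      exact add_mem (hq.2.1 Y hY hYD) (hq'.2.1 Y hY hYD)
    · rw [VectorField.mlieBracket_add_left hd hd']
      exact add_mem (hq.2.2 Y hY hYD) (hq'.2.2 Y hY hYD)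
  zero_mem' := by
    refine Filter.Eventually.of_forall fun q => ⟨?_, fun Y _ _ => ?_, fun Y _ _ => ?_⟩
    · exact Bundle.contMDiff_zeroSection ℂ (TangentSpace 𝓘(ℂ, E)) q
    · rw [VectorField.mlieBracket_zero_left]; exact zero_mem _
    · rw [VectorField.mlieBracket_zero_left]; exact zero_mem _
  smul_mem' := by
    intro c ξ hξ
    filter_upwards [hξ] with q hq
    have hd := hq.1.mdifferentiableAt (by simp)
    refine ⟨hq.1.const_smul_section, fun Y hY hYD => ?_, fun Y hY hYD => ?_⟩
    · rw [VectorField.mlieBracket_const_smul_left hd]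
      exact Submodule.smul_mem _ c (hq.2.1 Y hY hYD)
    · rw [VectorField.mlieBracket_const_smul_left hd]
      exact Submodule.smul_mem _ c (hq.2.2 Y hY hYD)

/-- The vector fields that vanish identically on some neighbourhood of `p`. -/
def vanishingNear (p : M) : Submodule ℂ (Π x : M, TangentSpace 𝓘(ℂ, E) x) where
  carrier := {ξ | ∀ᶠ q in 𝓝 p, ξ q = 0}
  add_mem' := by
    intro ξ ζ hξ hζ
    filter_upwards [hξ, hζ] with q hq hq'
    rw [Pi.add_apply, hq, hq', add_zero]
  zero_mem' := Filter.Eventually.of_forall fun _ => rfl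
  smul_mem' := by
    intro c ξ hξ
    filter_upwards [hξ] with q hq
    rw [Pi.smul_apply, hq, smul_zero]

/-- The complex vector space of germs at `p` of holomorphic infinitesimal symmetries of
`(M; D₁, D₂)`. -/
abbrev SymmetryGerms [CompleteSpace E] [IsManifold 𝓘(ℂ, E) ω M]
    (D₁ D₂ : Π x : M, Submodule ℂ (TangentSpace 𝓘(ℂ, E) x)) (p : M) : Type _ :=
  localSymmetries D₁ D₂ p ⧸ (vanishingNear p).comap (localSymmetries D₁ D₂ p).subtype

end Manifold

/-! ### The left-invariant structure on a complex Lie group -/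

section LieGroup

variable {E : Type*} [NormedAddCommGroup E] [NormedSpace ℂ E]
  {G : Type*} [TopologicalSpace G] [ChartedSpace E G] [Group G]

/-- The left-invariant distribution on `G` determined by a subspace `V` of its Lie algebra: at `x`
it consists of the left translates to `x` of the vectors in `V`. -/
def leftInvariantDistribution (V : Submodule ℂ (GroupLieAlgebra 𝓘(ℂ, E) G)) (x : G) :
    Submodule ℂ (TangentSpace 𝓘(ℂ, E) x) where
  carrier := {w | ∃ v ∈ V, mulInvariantVectorField v x = w}
  add_mem' := by
    rintro _ _ ⟨v, hv, rfl⟩ ⟨w, hw, rfl⟩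
    exact ⟨v + w, add_mem hv hw, congrFun (mulInvariantVectorField_add v w) x⟩
  zero_mem' := ⟨0, zero_mem V, by
    simpa using congrFun (mulInvariantVectorField_smul (I := 𝓘(ℂ, E)) (G := G) (0 : ℂ) 0) x⟩
  smul_mem' := by
    rintro c _ ⟨v, hv, rfl⟩
    exact ⟨c • v, V.smul_mem c hv, congrFun (mulInvariantVectorField_smul c v) x⟩

/-- The ILC symmetry dimension of `(𝔤; 𝔢, 𝔣)`, computed on a complex Lie group `G` whose Lie
algebra is identified with `𝔤` by `ι`: the dimension of the space of germs at the identity of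
holomorphic vector fields preserving both left-invariant distributions determined by `𝔢` and `𝔣`. -/
noncomputable def ilcSymDim [CompleteSpace E] [LieGroup 𝓘(ℂ, E) ω G]
    {𝔤 : Type*} [LieRing 𝔤] [LieAlgebra ℂ 𝔤]
    (ι : 𝔤 ≃ₗ⁅ℂ⁆ GroupLieAlgebra 𝓘(ℂ, E) G) (𝔢 𝔣 : LieSubalgebra ℂ 𝔤) : Cardinal :=
  Module.rank ℂ (SymmetryGerms
    (leftInvariantDistribution (G := G) (𝔢.toSubmodule.map ι.toLinearEquiv.toLinearMap))
    (leftInvariantDistribution (G := G) (𝔣.toSubmodule.map ι.toLinearEquiv.toLinearMap)) (1 : G))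

end LieGroup

/-! A nonzero twisted derivation `(D, φ)` of `𝔤` preserving `𝔢` and `𝔣` forces the symmetry
dimension to be at least six, and one can be written down whenever the conclusion fails.

Such a pair turns `𝔤 ⊕ ℂ` into a `𝔤`-module by `v · (x, t) = ([v, x] + t D v, t φ(v))`. Local
functions `Ξ` on the group with derivative `-v · Ξ` along each left-invariant field `v` form a
six-dimensional space, the value at the identity being arbitrary. If `x` is the first component of
`Ξ`, read in the left-invariant frame, its bracket with a constant-coefficient section `b` has
coefficient `t D b`, so both distributions are preserved; `t = 0` gives the right-invariant fields.
No solution is lost in passing to vector fields: if `x` vanishes near the identity, so does `t D v`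
for all `v`, whence `t = 0`. This is `six_le_ilcSymDim`. Local solvability
(`IsLieFrame.exists_equivariant`) uses that `𝔤` is solvable: an eigenfunctional splits off one
scalar equation at a time, each solved by the Poincaré lemma.

The rest is algebra. Write `a` for the ideal and `C = 𝔢 ⊕ 𝔣`. If `τ a ≠ a`, then `a ∩ τ a` has
dimension one or two. In dimension one `𝔤` has all its brackets in a central line and admits a
grading; in dimension two `a ∩ τ a` is a plane central in the four-dimensional ideal `a + τ a`, and
the position of its line in `C` decides between a semisimple and a nilpotent derivation
(`hasTwistedDerivation_of_map_ne`). If `τ a = a` but `𝔢` meets `a` in `x ≠ 0`, a nilpotent `D`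
sending a complement of `x` in `𝔢` to `x`, and likewise in `𝔣`, works with a suitable `φ`; that `φ`
is a character comes down to the reality of one structure constant, which the Jacobi identity
supplies (`hasTwistedDerivation_of_mem_ideal`). The statement for `𝔣` follows by applying `τ`. -/

/-! ### Analyticity of primitives. -/

section Analysis

variable {E : Type*} [NormedAddCommGroup E] [NormedSpace ℂ E]

/-- A function whose derivative is analytic is analytic. -/
theorem analyticAt_of_eventually_hasFDerivAt {f : E → ℂ} {α : E → E →L[ℂ] ℂ} {x : E}
    (hα : AnalyticAt ℂ α x) (h : ∀ᶠ y in 𝓝 x, HasFDerivAt f (α y) y) : AnalyticAt ℂ f x := by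
  obtain ⟨p, r₀, hp₀⟩ := hα
  obtain ⟨ε, hε, hball⟩ := Metric.eventually_nhds_iff_ball.1 h
  set r : ENNReal := min r₀ (ENNReal.ofReal ε) with hr
  have hr0 : 0 < r := lt_min hp₀.r_pos (by simpa using hε)
  have hp : HasFPowerSeriesOnBall α p x r := hp₀.mono hr0 (min_le_left _ _)
  -- Integrating `α (x + t y) y` over `t ∈ [0, 1]` term by term multiplies the degree `n` term by `∫
  -- t ^ n = 1 / (n + 1)`.
  let q : FormalMultilinearSeries ℂ E (E →L[ℂ] ℂ) := fun n => ((n + 1 : ℂ)⁻¹) • p n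
  have hq : p.radius ≤ q.radius := by
    refine FormalMultilinearSeries.radius_le_of_le fun n => ?_
    simp only [q, norm_smul, norm_inv]
    refine mul_le_of_le_one_left (norm_nonneg _) (inv_le_one_of_one_le₀ ?_)
    have : (1 : ℝ) ≤ n + 1 := by linarith [n.cast_nonneg (α := ℝ)]
    calc (1 : ℝ) ≤ n + 1 := this
      _ = ‖((n + 1 : ℕ) : ℂ)‖ := by rw [Complex.norm_natCast]; push_cast; ring
      _ = _ := by push_cast; ring_nf
  refine ⟨q.unshift (f x), r, ?_, hr0, ?_⟩
  · rw [FormalMultilinearSeries.radius_unshift]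
    exact hp.r_le.trans hq
  intro y hy
  have hyr : (‖y‖₊ : ENNReal) < r := by simpa [enorm_eq_nnnorm] using hy
  have hyε : ‖y‖ < ε := by
    have := hyr.trans_le (min_le_right _ _)
    rw [ENNReal.ofReal, ENNReal.coe_lt_coe] at this
    have h2 := NNReal.coe_lt_coe.2 this
    rwa [Real.coe_toNNReal _ hε.le] at h2
  have hseg : ∀ t ∈ Set.Icc (0 : ℝ) 1, ‖(t : ℂ) • y‖ ≤ ‖y‖ := by
    intro t ht
    rw [norm_smul, Complex.norm_real, Real.norm_of_nonneg ht.1]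
    exact mul_le_of_le_one_left (norm_nonneg _) ht.2
  have hterm : ∀ (t : ℝ) (n : ℕ), (p n fun _ => (t : ℂ) • y) y
      = (t : ℂ) ^ n * (p n fun _ => y) y := by
    intro t n
    rw [(p n).map_smul_univ (fun _ => (t : ℂ)) (fun _ => y)]
    simp
  have hsum : ∀ t ∈ Set.Icc (0 : ℝ) 1,
      HasSum (fun n => (t : ℂ) ^ n * (p n fun _ => y) y) (α (x + (t : ℂ) • y) y) := by
    intro t ht
    have h1 : (t : ℂ) • y ∈ Metric.eball (0 : E) r := by
      simp only [Metric.mem_eball, edist_zero_right, enorm_eq_nnnorm]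
      refine lt_of_le_of_lt ?_ hyr
      exact_mod_cast hseg t ht
    have h2 := (hp.hasSum h1).mapL (ContinuousLinearMap.apply ℂ ℂ y)
    simp only [ContinuousLinearMap.apply_apply, hterm] at h2
    exact h2
  have hderiv : ∀ t ∈ Set.uIcc (0 : ℝ) 1,
      HasDerivAt (fun t : ℝ => f (x + (t : ℂ) • y)) (α (x + (t : ℂ) • y) y) t := by
    intro t ht
    rw [Set.uIcc_of_le zero_le_one] at ht
    have h1 : HasFDerivAt f (α (x + (t : ℂ) • y)) (x + (t : ℂ) • y) := by
      apply hball
      simpa using (hseg t ht).trans_lt hyε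
    have h2 : HasDerivAt (fun t : ℝ => x + (t : ℂ) • y) y t := by
      simpa using ((Complex.ofRealCLM.hasDerivAt (x := t)).smul_const y).const_add x
    exact (h1.restrictScalars ℝ).comp_hasDerivAt t h2
  have hbound : Summable fun n => ‖p n‖ * ‖y‖ ^ n * ‖y‖ :=
    ((p.summable_norm_mul_pow (hyr.trans_le hp.r_le)).mul_right ‖y‖)
  have hmain : HasSum (fun n => ∫ t in (0 : ℝ)..1, (t : ℂ) ^ n * (p n fun _ => y) y)
      (∫ t in (0 : ℝ)..1, α (x + (t : ℂ) • y) y) := by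
    refine intervalIntegral.hasSum_integral_of_dominated_convergence
      (fun n _ => ‖p n‖ * ‖y‖ ^ n * ‖y‖) ?_ ?_ ?_ ?_ ?_
    · intro n
      exact Continuous.aestronglyMeasurable (by fun_prop)
    · intro n
      refine Filter.Eventually.of_forall fun t ht => ?_
      rw [Set.uIoc_of_le zero_le_one] at ht
      rw [← hterm]
      refine ((p n _).le_opNorm y).trans ?_
      gcongr
      refine ((p n).le_opNorm _).trans ?_
      gcongr
      simpa using pow_le_pow_left₀ (norm_nonneg _) (hseg t ⟨ht.1.le, ht.2⟩) n
    · exact Filter.Eventually.of_forall fun t _ => hbound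
    · exact intervalIntegrable_const
    · refine Filter.Eventually.of_forall fun t ht => ?_
      rw [Set.uIoc_of_le zero_le_one] at ht
      exact hsum t ⟨ht.1.le, ht.2⟩
  have hcont : ContinuousOn (fun t : ℝ => α (x + (t : ℂ) • y) y) (Set.uIcc 0 1) := by
    intro t ht
    rw [Set.uIcc_of_le zero_le_one] at ht
    have h1 : x + (t : ℂ) • y ∈ Metric.eball x r := by
      simp only [Metric.mem_eball, edist_eq_enorm_sub, add_sub_cancel_left, enorm_eq_nnnorm]
      refine lt_of_le_of_lt ?_ hyr
      exact_mod_cast hseg t ht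
    have h2 : ContinuousAt α (x + (t : ℂ) • y) := (hp.analyticAt_of_mem h1).continuousAt
    have h3 : ContinuousAt (fun t : ℝ => α (x + (t : ℂ) • y)) t :=
      ContinuousAt.comp (f := fun t : ℝ => x + (t : ℂ) • y) h2 (by fun_prop)
    exact (h3.clm_apply continuousAt_const).continuousWithinAt
  have hftc := intervalIntegral.integral_eq_sub_of_hasDerivAt hderiv hcont.intervalIntegrable
  rw [hftc] at hmain
  -- The degree-zero term of `q.unshift (f x)` is `f x`; the remaining terms must sum to `f (x + y)
  -- - f x`.
  rw [← hasSum_nat_add_iff' 1]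
  convert! hmain using 1
  · ext n
    have h1 : ∫ t in (0 : ℝ)..1, (t : ℂ) ^ n * (p n fun _ => y) y
        = (n + 1 : ℂ)⁻¹ * (p n fun _ => y) y := by
      rw [intervalIntegral.integral_mul_const]
      congr 1
      have := integral_pow (a := 0) (b := 1) n
      have h2 : ∫ t in (0 : ℝ)..1, (t : ℂ) ^ n = ((∫ t in (0 : ℝ)..1, t ^ n : ℝ) : ℂ) := by
        rw [← intervalIntegral.integral_ofReal]
        simp
      rw [h2, this]
      simp
    rw [h1]
    simp only [FormalMultilinearSeries.unshift, q,
      continuousMultilinearCurryRightEquiv_symm_apply']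
    rfl
  · simp [FormalMultilinearSeries.unshift]

end Analysis

/-! ### Lie frames and scalar primitives. -/

section Frame

open VectorField

variable {E : Type*} [NormedAddCommGroup E] [NormedSpace ℂ E]
  {𝔤 : Type*} [LieRing 𝔤] [LieAlgebra ℂ 𝔤]

/-- A holomorphic frame on the open set `U`, indexed by the vector space `E`, whose brackets are
those of the Lie algebra `𝔤` under the identification `κ`. -/
structure IsLieFrame (κ : E ≃ₗ[ℂ] 𝔤) (V : E → E →L[ℂ] E) (U : Set E) : Prop where
  isOpen : IsOpen U
  contDiffOn : ContDiffOn ℂ ω V U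
  isInvertible : ∀ y ∈ U, (V y).IsInvertible
  lie : ∀ y ∈ U, ∀ a b, lieBracket ℂ (fun z => V z a) (fun z => V z b) y
    = V y (κ.symm ⁅κ a, κ b⁆)

namespace IsLieFrame

variable {κ : E ≃ₗ[ℂ] 𝔤} {V : E → E →L[ℂ] E} {U : Set E}

theorem mono (hV : IsLieFrame κ V U) {U' : Set E} (hU' : IsOpen U') (h : U' ⊆ U) :
    IsLieFrame κ V U' :=
  ⟨hU', hV.contDiffOn.mono h, fun y hy => hV.isInvertible y (h hy), fun y hy => hV.lie y (h hy)⟩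

theorem contDiffAt (hV : IsLieFrame κ V U) {y : E} (hy : y ∈ U) : ContDiffAt ℂ ω V y :=
  hV.contDiffOn.contDiffAt (hV.isOpen.mem_nhds hy)

theorem hasFDerivAt (hV : IsLieFrame κ V U) {y : E} (hy : y ∈ U) :
    HasFDerivAt V (fderiv ℂ V y) y :=
  ((hV.contDiffAt hy).differentiableAt (by simp)).hasFDerivAt

theorem fderiv_sub_fderiv (hV : IsLieFrame κ V U) {y : E} (hy : y ∈ U) (a b : E) :
    fderiv ℂ V y (V y a) b - fderiv ℂ V y (V y b) a = V y (κ.symm ⁅κ a, κ b⁆) := by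
  rw [← hV.lie y hy, lieBracket_eq]
  have h (c : E) : fderiv ℂ (fun z => V z c) y = (fderiv ℂ V y).flip c := by
    have := ((hV.hasFDerivAt hy).clm_apply (hasFDerivAt_const c y)).fderiv
    rw [this]
    ext; simp
  simp [h]

/-- A one-form that is closed, expressed in a Lie frame, has a holomorphic primitive. -/
theorem exists_primitive [CompleteSpace E] (hV : IsLieFrame κ V U) {y₀ : E} (hy₀ : y₀ ∈ U)
    {θ : E → E →L[ℂ] ℂ} (hθ : ContDiffOn ℂ ω θ U)
    (hclosed : ∀ y ∈ U, ∀ a b, fderiv ℂ θ y (V y a) b - fderiv ℂ θ y (V y b) a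
      = θ y (κ.symm ⁅κ a, κ b⁆)) :
    ∃ U' ⊆ U, IsOpen U' ∧ y₀ ∈ U' ∧ ∃ h : E → ℂ, ContDiffOn ℂ ω h U' ∧ h y₀ = 0 ∧
      ∀ y ∈ U', ∀ a, fderiv ℂ h y (V y a) = θ y a := by
  set α : E → E →L[ℂ] ℂ := fun y => (θ y).comp (V y).inverse with hα
  have hαs : ∀ y ∈ U, ContDiffAt ℂ ω α y := by
    intro y hy
    refine ContDiffAt.clm_comp (hθ.contDiffAt (hV.isOpen.mem_nhds hy)) ?_
    obtain ⟨e, he⟩ := hV.isInvertible y hy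
    have := contDiffAt_map_inverse (n := ω) e
    rw [he] at this
    exact ContDiffAt.comp (f := V) y this (hV.contDiffAt hy)
  have hαV : ∀ y ∈ U, ∀ a, α y (V y a) = θ y a := by
    intro y hy a
    obtain ⟨e, he⟩ := hV.isInvertible y hy
    simp [hα, ← he]
  have hsymm : ∀ y ∈ U, ∀ a b, fderiv ℂ α y a b = fderiv ℂ α y b a := by
    intro y hy
    have key : ∀ a b, fderiv ℂ θ y (V y a) b
        = fderiv ℂ α y (V y a) (V y b) + α y (fderiv ℂ V y (V y a) b) := by
      intro a b
      have h1 : HasFDerivAt α (fderiv ℂ α y) y :=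
        ((hαs y hy).differentiableAt (by simp)).hasFDerivAt
      have h2 := h1.clm_apply ((hV.hasFDerivAt hy).clm_apply (hasFDerivAt_const b y))
      have h3 : HasFDerivAt θ (fderiv ℂ θ y) y :=
        ((hθ.contDiffAt (hV.isOpen.mem_nhds hy)).differentiableAt (by simp)).hasFDerivAt
      have h4 := h3.clm_apply (hasFDerivAt_const b y)
      have h5 : (fun z => α z (V z b)) =ᶠ[𝓝 y] fun z => θ z b :=
        Filter.eventually_of_mem (hV.isOpen.mem_nhds hy) fun z hz => hαV z hz b
      have h6 := (h2.congr_of_eventuallyEq h5.symm).unique h4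
      have h7 := DFunLike.congr_fun h6 (V y a)
      simp at h7
      rw [← h7]; ring
    have key2 : ∀ a b, fderiv ℂ α y (V y a) (V y b) = fderiv ℂ α y (V y b) (V y a) := by
      intro a b
      have h1 := hclosed y hy a b
      rw [key, key, ← hαV y hy, ← hV.fderiv_sub_fderiv hy, map_sub] at h1
      linear_combination h1
    obtain ⟨e, he⟩ := hV.isInvertible y hy
    intro a b
    have := key2 (e.symm a) (e.symm b)
    simpa [← he] using this
  obtain ⟨ε, hε, hball⟩ := Metric.isOpen_iff.1 hV.isOpen y₀ hy₀
  have hconv : Convex ℝ (Metric.ball y₀ ε) := convex_ball _ _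
  have hd : ∀ y ∈ U, DifferentiableAt ℂ α y := fun y hy => (hαs y hy).differentiableAt (by simp)
  obtain ⟨f, hf⟩ : ∃ f, ∀ a ∈ Metric.ball y₀ ε, HasFDerivAt f (α a) a := hconv.exists_forall_hasFDerivAt_of_fderiv_symmetric Metric.isOpen_ball
    (fun y hy => ((hd y (hball hy)).restrictScalars ℝ).differentiableWithinAt)
    (fun y hy a b => by
      rw [(hd y (hball hy)).fderiv_restrictScalars ℝ]
      exact hsymm y (hball hy) a b)
  refine ⟨Metric.ball y₀ ε, hball, Metric.isOpen_ball, Metric.mem_ball_self hε,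
    fun y => f y - f y₀, ?_, by simp, ?_⟩
  · refine ContDiffOn.sub (fun y hy => ?_) contDiffOn_const
    refine (analyticAt_of_eventually_hasFDerivAt 
      (hαs y (hball hy)).analyticAt ?_).contDiffAt.contDiffWithinAt
    exact Filter.eventually_of_mem (Metric.isOpen_ball.mem_nhds hy) hf
  · intro y hy a
    rw [((hf y hy).sub_const _).fderiv, hαV y (hball hy)]

/-- Twisted version of `IsLieFrame.exists_primitive` for a character `χ` of the Lie algebra. -/
theorem exists_twisted_primitive [CompleteSpace E] (hV : IsLieFrame κ V U) {y₀ : E} (hy₀ : y₀ ∈ U)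
    (χ : E →L[ℂ] ℂ) (hχ : ∀ a b, χ (κ.symm ⁅κ a, κ b⁆) = 0)
    {θ : E → E →L[ℂ] ℂ} (hθ : ContDiffOn ℂ ω θ U)
    (hclosed : ∀ y ∈ U, ∀ a b, fderiv ℂ θ y (V y a) b - fderiv ℂ θ y (V y b) a
      + χ a * θ y b - χ b * θ y a = θ y (κ.symm ⁅κ a, κ b⁆)) :
    ∃ U' ⊆ U, IsOpen U' ∧ y₀ ∈ U' ∧ ∃ h : E → ℂ, ContDiffOn ℂ ω h U' ∧ h y₀ = 0 ∧
      ∀ y ∈ U', ∀ a, fderiv ℂ h y (V y a) = - χ a * h y + θ y a := by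
  -- A character is itself a closed form, say `dg = χ`. The integrating factor `exp g` then removes
  -- the twist: `exp g • θ` is closed with primitive `k`, and `exp (-g) * k` is the solution.
  obtain ⟨U₁, hU₁, ho₁, hy₁, g, hg, -, hgV⟩ := hV.exists_primitive hy₀ (θ := fun _ => χ)
    contDiffOn_const (by simp [hχ])
  have hdg : ∀ y ∈ U₁, HasFDerivAt g (fderiv ℂ g y) y := fun y hy =>
    ((hg.contDiffAt (ho₁.mem_nhds hy)).differentiableAt (by simp)).hasFDerivAt
  obtain ⟨U₂, hU₂, ho₂, hy₂, k, hk, hk0, hkV⟩ := (hV.mono ho₁ hU₁).exists_primitive hy₁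
    (θ := fun y => Complex.exp (g y) • θ y) (hg.cexp.smul (hθ.mono hU₁)) (by
      intro y hy a b
      have h1 : HasFDerivAt θ (fderiv ℂ θ y) y :=
        ((hθ.contDiffAt (hV.isOpen.mem_nhds (hU₁ hy))).differentiableAt (by simp)).hasFDerivAt
      have h2 := ((hdg y hy).cexp.fun_smul h1).fderiv
      simp only [h2]
      have h3 := hclosed y (hU₁ hy) a b
      simp [hgV y hy]
      linear_combination Complex.exp (g y) * h3)
  refine ⟨U₂, hU₂.trans hU₁, ho₂, hy₂, fun y => Complex.exp (- g y) * k y, ?_, by simp [hk0], ?_⟩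
  · exact (hg.mono hU₂).neg.cexp.mul hk
  · intro y hy a
    have h1 : HasFDerivAt k (fderiv ℂ k y) y :=
      ((hk.contDiffAt (ho₂.mem_nhds hy)).differentiableAt (by simp)).hasFDerivAt
    have h2 := ((hdg y (hU₂ hy)).fun_neg.cexp.fun_mul h1).fderiv
    rw [h2]
    have h3 : Complex.exp (- g y) * Complex.exp (g y) = 1 := by
      rw [← Complex.exp_add]; simp
    simp [hgV y (hU₂ hy), hkV y hy]
    linear_combination (θ y a) * h3

end IsLieFrame

end Frame

/-! ### Integrating representations of solvable Lie algebras. -/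

section Representation

variable {𝔤 : Type*} [LieRing 𝔤] [LieAlgebra ℂ 𝔤]

/-- A nonzero finite-dimensional module of a solvable Lie algebra has an eigenfunctional. -/
theorem LieSubmodule.exists_eigenfunctional [LieAlgebra.IsSolvable 𝔤] {W : Type*} [AddCommGroup W]
    [Module ℂ W] [FiniteDimensional ℂ W] [LieRingModule 𝔤 W] [LieModule ℂ 𝔤 W]
    (S : LieSubmodule ℂ 𝔤 W) (hS : S ≠ ⊥) :
    ∃ (l : W →ₗ[ℂ] ℂ) (χ : 𝔤 →ₗ[ℂ] ℂ), (∃ w ∈ S, l w = 1) ∧ (∀ x : 𝔤, ∀ w ∈ S, l ⁅x, w⁆ = χ x * l w) ∧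
      ∀ x y : 𝔤, χ ⁅x, y⁆ = 0 := by
  have : Nontrivial S := (LieSubmodule.nontrivial_iff_ne_bot ℂ 𝔤 (N := S)).2 hS
  -- Lie's theorem is applied to the dual module, since a functional rather than a vector is needed;
  -- dualising accounts for the sign in `-χ` below.
  obtain ⟨χ, hχ⟩ := LieModule.exists_nontrivial_weightSpace_of_isSolvable ℂ 𝔤 (Module.Dual ℂ S)
  obtain ⟨⟨l₀, hl₀⟩, hne⟩ := exists_ne (0 : LieModule.weightSpace (Module.Dual ℂ S) χ)
  rw [LieModule.mem_weightSpace] at hl₀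
  have hne' : l₀ ≠ 0 := fun h => hne (Subtype.ext h)
  obtain ⟨⟨w₀, hw₀⟩, hw⟩ : ∃ w, l₀ w ≠ 0 := by
    by_contra! h
    exact hne' (LinearMap.ext h)
  have hl : ∀ x (w : S), l₀ ⁅x, w⁆ = - χ x * l₀ w := by
    intro x w
    have := LinearMap.congr_fun (hl₀ x) w
    simp only [Module.Dual.lie_apply, LinearMap.smul_apply, smul_eq_mul] at this
    linear_combination -this
  obtain ⟨l, hl'⟩ := LinearMap.exists_extend (p := S.toSubmodule) l₀
  have hll : ∀ w (h : w ∈ S), l w = l₀ ⟨w, h⟩ := fun w h => LinearMap.congr_fun hl' ⟨w, h⟩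
  have heig : ∀ x, ∀ w ∈ S, l ⁅x, w⁆ = (-χ) x * l w := by
    intro x w h
    rw [hll w h, hll _ (S.lie_mem h)]
    exact hl x ⟨w, h⟩
  refine ⟨(l w₀)⁻¹ • l, -χ, ⟨w₀, hw₀, ?_⟩, ?_, ?_⟩
  · rw [← hll w₀ hw₀] at hw
    simp [hw]
  · intro x w h
    simp only [LinearMap.smul_apply, smul_eq_mul, heig x w h]
    ring
  · intro x y
    rw [← hll w₀ hw₀] at hw
    have h1 := heig ⁅x, y⁆ w₀ hw₀
    rw [lie_lie, map_sub, heig _ _ (S.lie_mem hw₀), heig _ _ (S.lie_mem hw₀), heig _ _ hw₀,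
      heig _ _ hw₀] at h1
    have h2 : (-χ) ⁅x, y⁆ * l w₀ = 0 := by rw [← h1]; ring
    exact (mul_eq_zero.1 h2).resolve_right hw

variable {E : Type*} [NormedAddCommGroup E] [NormedSpace ℂ E] [FiniteDimensional ℂ E]
  {W : Type*} [NormedAddCommGroup W] [NormedSpace ℂ W] [FiniteDimensional ℂ W]
  [LieRingModule 𝔤 W] [LieModule ℂ 𝔤 W]

namespace IsLieFrame

variable {κ : E ≃ₗ[ℂ] 𝔤} {V : E → E →L[ℂ] E}

/-- A closed one-form with values in a submodule of a representation of a solvable Lie algebra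
has a primitive with values in that submodule. -/
theorem exists_primitive_mem [LieAlgebra.IsSolvable 𝔤] {y₀ : E} (n : ℕ) :
    ∀ (S : LieSubmodule ℂ 𝔤 W), Module.finrank ℂ S = n → ∀ {U : Set E}, IsLieFrame κ V U →
    y₀ ∈ U → ∀ {θ : E → E →L[ℂ] W}, ContDiffOn ℂ ω θ U → (∀ y ∈ U, ∀ a, θ y a ∈ S) →
    (∀ y ∈ U, ∀ a b, fderiv ℂ θ y (V y a) b - fderiv ℂ θ y (V y b) a
      + ⁅κ a, θ y b⁆ - ⁅κ b, θ y a⁆ = θ y (κ.symm ⁅κ a, κ b⁆)) →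
    ∃ U' ⊆ U, IsOpen U' ∧ y₀ ∈ U' ∧ ∃ Ξ : E → W, ContDiffOn ℂ ω Ξ U' ∧ Ξ y₀ = 0 ∧
      ∀ y ∈ U', ∀ a, fderiv ℂ Ξ y (V y a) = - ⁅κ a, Ξ y⁆ + θ y a := by
  have : CompleteSpace E := FiniteDimensional.complete ℂ E
  induction n using Nat.strong_induction_on with
  | _ n ih =>
  intro S hn U hV hy₀ θ hθ hθS hclosed
  by_cases hS : S = ⊥
  · subst hS
    refine ⟨U, le_rfl, hV.isOpen, hy₀, 0, contDiffOn_const, rfl, fun y hy a => ?_⟩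
    have := hθS y hy a
    rw [LieSubmodule.mem_bot] at this
    simp [this]
  obtain ⟨l₀, χ₀, ⟨w₁, hw₁, hlw₁⟩, hl, hχ⟩ := S.exists_eigenfunctional hS
  set l : W →L[ℂ] ℂ := LinearMap.toContinuousLinearMap l₀ with hldef
  set χ : E →L[ℂ] ℂ := LinearMap.toContinuousLinearMap (χ₀ ∘ₗ κ.toLinearMap) with hχdef
  set R : E →L[ℂ] W := LinearMap.toContinuousLinearMap
    (((LieModule.toEnd ℂ 𝔤 W : 𝔤 →ₗ[ℂ] Module.End ℂ W).flip w₁) ∘ₗ κ.toLinearMap) with hRdef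
  have hRa : ∀ a, R a = ⁅κ a, w₁⁆ := fun a => rfl
  have hχa : ∀ a, χ a = χ₀ (κ a) := fun a => rfl
  have hla : ∀ w, l w = l₀ w := fun w => rfl
  have hdθ : ∀ y ∈ U, HasFDerivAt θ (fderiv ℂ θ y) y := fun y hy =>
    ((hθ.contDiffAt (hV.isOpen.mem_nhds hy)).differentiableAt (by simp)).hasFDerivAt
  have hleig : ∀ a, ∀ w ∈ S, l ⁅κ a, w⁆ = χ a * l w := fun a w hw => hl _ _ hw
  obtain ⟨U₁, hU₁, ho₁, hy₁, h, hh, hh0, hhV⟩ := hV.exists_twisted_primitive hy₀ χ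
    (fun a b => by simp [hχa, hχ]) (θ := fun y => l.comp (θ y)) (contDiffOn_const.clm_comp hθ) (by
      intro y hy a b
      have h1 := ((hasFDerivAt_const l y).clm_comp (hdθ y hy)).fderiv
      rw [h1]
      have h2 := congrArg l (hclosed y hy a b)
      simp only [map_sub, map_add, hleig _ _ (hθS y hy _)] at h2
      simpa using h2)
  set P : ℂ →L[ℂ] W := ContinuousLinearMap.toSpanSingleton ℂ w₁ with hP
  have hPa : ∀ c, P c = c • w₁ := fun c => rfl
  have hdh : ∀ y ∈ U₁, HasFDerivAt h (fderiv ℂ h y) y := fun y hy =>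
    ((hh.contDiffAt (ho₁.mem_nhds hy)).differentiableAt (by simp)).hasFDerivAt
  -- Writing the unknown as `Ξ + h • w₁`, where `h` solves the scalar equation obtained by applying
  -- `l`, leaves an equation for `Ξ` with right-hand side `θ'`. Because `l w₁ = 1`, the form `θ'`
  -- takes values in `S ∩ ker l`, which has smaller dimension.
  set θ' : E → E →L[ℂ] W := fun y =>
    θ y - h y • R + (h y • (P.comp χ) - (P.comp l).comp (θ y)) with hθ'
  have hθ'a : ∀ y a, θ' y a = θ y a - h y • ⁅κ a, w₁⁆ + (h y * χ a - l (θ y a)) • w₁ := by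
    intro y a
    simp [hθ', hRa, hPa, sub_smul, mul_smul]
  let S' : LieSubmodule ℂ 𝔤 W :=
    { S.toSubmodule ⊓ LinearMap.ker l₀ with
      lie_mem := by
        rintro x w ⟨hw, hw'⟩
        refine ⟨S.lie_mem hw, ?_⟩
        have hw'' : l₀ w = 0 := hw'
        show l₀ ⁅x, w⁆ = 0
        rw [hl x w hw, hw'', mul_zero] }
  have hlt : Module.finrank ℂ S' < n := by
    rw [← hn]
    refine Submodule.finrank_lt_finrank_of_lt (s := S'.toSubmodule) (t := S.toSubmodule) ?_
    refine lt_of_le_of_ne (fun w hw => hw.1) fun heq => ?_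
    have : w₁ ∈ S'.toSubmodule := heq ▸ hw₁
    have h0 : l₀ w₁ = 0 := this.2
    simp [hlw₁] at h0
  have hθs' : ContDiffOn ℂ ω θ' U₁ :=
    ((hθ.mono hU₁).sub (hh.smul contDiffOn_const)).add
      ((hh.smul contDiffOn_const).sub (contDiffOn_const.clm_comp (hθ.mono hU₁)))
  obtain ⟨U₂, hU₂, ho₂, hy₂, Ξ, hΞ, hΞ0, hΞV⟩ := ih _ hlt S' rfl (hV.mono ho₁ hU₁) hy₁ hθs'
    (by
      intro y hy a
      have hm := hθS y (hU₁ hy) a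
      rw [hθ'a]
      refine ⟨add_mem (sub_mem hm (S.smul_mem _ (S.lie_mem hw₁))) (S.smul_mem _ hw₁), ?_⟩
      show l₀ _ = 0
      simp only [map_add, map_sub, map_smul, hl _ _ hw₁, hlw₁, smul_eq_mul, hχa, hla]
      ring)
    (by
      intro y hy a b
      have hd : ∀ a b, fderiv ℂ θ' y (V y a) b = fderiv ℂ θ y (V y a) b
          - (- χ a * h y + l (θ y a)) • ⁅κ b, w₁⁆
          + ((- χ a * h y + l (θ y a)) * χ b - l (fderiv ℂ θ y (V y a) b)) • w₁ := by
        intro a b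
        have h1 := (((hdθ y (hU₁ hy)).fun_sub ((hdh y hy).fun_smul (hasFDerivAt_const R y))).fun_add
          (((hdh y hy).fun_smul (hasFDerivAt_const (P.comp χ) y)).fun_sub
            ((hasFDerivAt_const (P.comp l) y).clm_comp (hdθ y (hU₁ hy))))).fderiv
        rw [hθ', h1]
        simp [hhV y hy, hRa, hPa, sub_smul, mul_smul]
      have h2 := hclosed y (hU₁ hy) a b
      have h3 := congrArg l h2
      simp only [map_sub, map_add, hleig _ _ (hθS y (hU₁ hy) _)] at h3
      have h4 : ⁅κ (κ.symm ⁅κ a, κ b⁆), w₁⁆ = ⁅κ a, ⁅κ b, w₁⁆⁆ - ⁅κ b, ⁅κ a, w₁⁆⁆ := by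
        rw [LinearEquiv.apply_symm_apply, lie_lie]
      have h5 : χ (κ.symm ⁅κ a, κ b⁆) = 0 := by simp [hχa, hχ]
      rw [hd, hd, hθ'a, hθ'a, hθ'a, h4, h5]
      simp only [lie_add, lie_sub, lie_smul]
      rw [← h3, ← h2]
      module)
  refine ⟨U₂, hU₂.trans hU₁, ho₂, hy₂, fun y => Ξ y + h y • w₁,
    hΞ.add ((hh.mono hU₂).smul contDiffOn_const), by simp [hΞ0, hh0], fun y hy a => ?_⟩
  have h1 : HasFDerivAt Ξ (fderiv ℂ Ξ y) y :=
    ((hΞ.contDiffAt (ho₂.mem_nhds hy)).differentiableAt (by simp)).hasFDerivAt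
  have h2 := (h1.fun_add ((hdh y (hU₂ hy)).fun_smul (hasFDerivAt_const w₁ y))).fderiv
  rw [h2]
  simp [hΞV y hy, hhV y (hU₂ hy), hθ'a]
  module

/-- A finite-dimensional representation of a solvable Lie algebra integrates locally along a
Lie frame. -/
theorem exists_equivariant [LieAlgebra.IsSolvable 𝔤] {U : Set E} (hV : IsLieFrame κ V U) {y₀ : E}
    (hy₀ : y₀ ∈ U) (w : W) :
    ∃ U' ⊆ U, IsOpen U' ∧ y₀ ∈ U' ∧ ∃ Ξ : E → W, ContDiffOn ℂ ω Ξ U' ∧ Ξ y₀ = w ∧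
      ∀ y ∈ U', ∀ a, fderiv ℂ Ξ y (V y a) = - ⁅κ a, Ξ y⁆ := by
  set R : E →L[ℂ] W := LinearMap.toContinuousLinearMap
    (((LieModule.toEnd ℂ 𝔤 W : 𝔤 →ₗ[ℂ] Module.End ℂ W).flip w) ∘ₗ κ.toLinearMap) with hRdef
  have hRa : ∀ a, R a = ⁅κ a, w⁆ := fun a => rfl
  -- The difference between the sought function and the constant `w` vanishes at `y₀` and solves the
  -- inhomogeneous equation with form `a ↦ -⁅κ a, w⁆`; this form is closed by the module identity.
  obtain ⟨U', hU', ho, hy, Ξ, hΞ, hΞ0, hΞV⟩ := exists_primitive_mem (W := W) _ ⊤ rfl hV hy₀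
    (θ := fun _ => - R) contDiffOn_const (fun _ _ _ => LieSubmodule.mem_top _) (by
      intro y hy a b
      simp [hRa]
      abel)
  refine ⟨U', hU', ho, hy, fun y => Ξ y + w, hΞ.add contDiffOn_const, by simp [hΞ0], ?_⟩
  intro y hy a
  simp [hΞV y hy, hRa]
  abel

end IsLieFrame

end Representation

/-! ### Left-invariant fields in the chart at the identity. -/

section LieGroupFrame

open VectorField Bundle

variable {E : Type*} [NormedAddCommGroup E] [NormedSpace ℂ E]
  {G : Type*} [TopologicalSpace G] [ChartedSpace E G] [Group G]

variable (E G) in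
/-- The inverse of the chart at the identity. -/
noncomputable abbrev chartInv : E → G := (extChartAt 𝓘(ℂ, E) (1 : G)).symm

variable (E G) in
/-- The domain of `chartInv`. -/
abbrev chartDomain : Set E := (extChartAt 𝓘(ℂ, E) (1 : G)).target

variable (E G) in
/-- The left-invariant vector fields in the chart at the identity. -/
noncomputable def chartFrame (y : E) : E →L[ℂ] E :=
  ((mfderiv 𝓘(ℂ, E) 𝓘(ℂ, E) (chartInv E G) y).inverse : E →L[ℂ] E).comp
    (mfderiv 𝓘(ℂ, E) 𝓘(ℂ, E) (fun h : G => chartInv E G y * h) 1 : E →L[ℂ] E)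

theorem isOpen_chartDomain : IsOpen (chartDomain E G) := isOpen_extChartAt_target 1

variable [LieGroup 𝓘(ℂ, E) ω G]

/-- Left-invariant vector fields on a complex Lie group are holomorphic. -/
theorem contMDiff_omega_mulInvariantVectorField (v : GroupLieAlgebra 𝓘(ℂ, E) G) :
    ContMDiff 𝓘(ℂ, E) 𝓘(ℂ, E).tangent ω
      (fun g : G => (⟨g, mulInvariantVectorField v g⟩ : TangentBundle 𝓘(ℂ, E) G)) := by
  have sfg : ContMDiff 𝓘(ℂ, E) 𝓘(ℂ, E).tangent ω
      (fun g : G => (TotalSpace.mk' E g 0 : TangentBundle 𝓘(ℂ, E) G)) :=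
    contMDiff_zeroSection _ _
  have sfv : ContMDiff 𝓘(ℂ, E) 𝓘(ℂ, E).tangent ω
      (fun _ : G => (TotalSpace.mk' E 1 v : TangentBundle 𝓘(ℂ, E) G)) := contMDiff_const
  have S₁ := sfg.prodMk sfv
  have S₂ : ContMDiff (𝓘(ℂ, E).tangent.prod 𝓘(ℂ, E).tangent) (𝓘(ℂ, E).prod 𝓘(ℂ, E)).tangent ω
      (equivTangentBundleProd 𝓘(ℂ, E) G 𝓘(ℂ, E) G).symm := contMDiff_equivTangentBundleProd_symm
  have S₃ : ContMDiff (𝓘(ℂ, E).prod 𝓘(ℂ, E)).tangent 𝓘(ℂ, E).tangent ω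
      (tangentMap (𝓘(ℂ, E).prod 𝓘(ℂ, E)) 𝓘(ℂ, E) (fun p : G × G => p.1 * p.2)) :=
    ContMDiff.contMDiff_tangentMap (contMDiff_mul 𝓘(ℂ, E) ω) (m := ω) le_rfl
  have S := (S₃.comp S₂).comp S₁
  convert! S with g
  · simp
  · simp only [Function.comp_apply, tangentMap]
    rw [mfderiv_prod_eq_add_apply ((contMDiff_mul 𝓘(ℂ, E) ω).mdifferentiableAt (by simp))]
    exact ((zero_add _).symm.trans (congrArg₂ (· + ·) (map_zero _).symm rfl))

theorem contMDiffAt_chartInv {y : E} (hy : y ∈ chartDomain E G) :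
    ContMDiffAt 𝓘(ℂ, E) 𝓘(ℂ, E) ω (chartInv E G) y :=
  (contMDiffOn_extChartAt_symm (1 : G)).contMDiffAt (isOpen_chartDomain.mem_nhds hy)

theorem isInvertible_mfderiv_chartInv {y : E} (hy : y ∈ chartDomain E G) :
    (mfderiv 𝓘(ℂ, E) 𝓘(ℂ, E) (chartInv E G) y).IsInvertible := by
  have : IsManifold 𝓘(ℂ, E) 1 G := IsManifold.of_le (n := ω) le_top
  have := isInvertible_mfderivWithin_extChartAt_symm (I := 𝓘(ℂ, E)) hy
  rw [ModelWithCorners.Boundaryless.range_eq_univ, mfderivWithin_univ] at this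
  exact this

theorem isInvertible_mfderiv_mul_left (g : G) :
    (mfderiv 𝓘(ℂ, E) 𝓘(ℂ, E) (fun h : G => g * h) 1).IsInvertible := by
  have hd : ∀ g h : G, MDifferentiableAt 𝓘(ℂ, E) 𝓘(ℂ, E) (fun x : G => g * x) h := fun g h =>
    (contMDiff_mul_left (I := 𝓘(ℂ, E)) (n := ω)).contMDiffAt.mdifferentiableAt (by simp)
  have A : mfderiv 𝓘(ℂ, E) 𝓘(ℂ, E) ((fun x : G => g⁻¹ * x) ∘ (fun x => g * x)) 1 =
      ContinuousLinearMap.id _ _ := by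
    have : (fun x : G => g⁻¹ * x) ∘ (fun x => g * x) = id := by ext x; simp
    rw [this, id_eq, mfderiv_id]
  have A' : mfderiv 𝓘(ℂ, E) 𝓘(ℂ, E) ((fun x : G => g * x) ∘ (fun x => g⁻¹ * x)) (g * 1) =
      ContinuousLinearMap.id _ _ := by
    have : (fun x : G => g * x) ∘ (fun x => g⁻¹ * x) = id := by ext x; simp
    rw [this, id_eq, mfderiv_id]
  rw [mfderiv_comp (I' := 𝓘(ℂ, E)) _ (hd _ _) (hd _ _)] at A
  rw [mfderiv_comp (I' := 𝓘(ℂ, E)) _ (hd _ _) (hd _ _), inv_mul_cancel_left] at A'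
  exact ContinuousLinearMap.IsInvertible.of_inverse A' A

theorem contDiffAt_mpullback_chartInv [CompleteSpace E] {Y : Π x : G, TangentSpace 𝓘(ℂ, E) x}
    {y : E} (hy : y ∈ chartDomain E G) (hY : HolomorphicVectorFieldAt Y (chartInv E G y)) :
    ContDiffAt ℂ ω (mpullback 𝓘(ℂ, E) 𝓘(ℂ, E) (chartInv E G) Y : E → E) y := by
  rw [← contMDiffAt_vectorSpace_iff_contDiffAt]
  exact ContMDiffAt.mpullback_vectorField_preimage (n := ω) hY (contMDiffAt_chartInv hy)
    (isInvertible_mfderiv_chartInv hy) le_rfl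

theorem mpullback_chartInv_mlieBracket [CompleteSpace E] {X Y : Π x : G, TangentSpace 𝓘(ℂ, E) x}
    {y : E} (hy : y ∈ chartDomain E G) (hX : HolomorphicVectorFieldAt X (chartInv E G y))
    (hY : HolomorphicVectorFieldAt Y (chartInv E G y)) :
    mpullback 𝓘(ℂ, E) 𝓘(ℂ, E) (chartInv E G) (mlieBracket 𝓘(ℂ, E) X Y) y =
      lieBracket ℂ (mpullback 𝓘(ℂ, E) 𝓘(ℂ, E) (chartInv E G) X : E → E)
        (mpullback 𝓘(ℂ, E) 𝓘(ℂ, E) (chartInv E G) Y : E → E) y := by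
  rw [mpullback_mlieBracket (n := ω) (hX.mdifferentiableAt (by simp))
    (hY.mdifferentiableAt (by simp)) (contMDiffAt_chartInv hy) le_top]
  rw [← mlieBracketWithin_univ]
  exact (congrFun (mlieBracketWithin_eq_lieBracketWithin (s := Set.univ)) y).trans
    (congrFun lieBracketWithin_univ y)

variable {𝔤 : Type*} [LieRing 𝔤] [LieAlgebra ℂ 𝔤]

/-- The identification of the model space with the Lie algebra. -/
noncomputable def modelEquiv [CompleteSpace E] (ι : 𝔤 ≃ₗ⁅ℂ⁆ GroupLieAlgebra 𝓘(ℂ, E) G) :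
    E ≃ₗ[ℂ] 𝔤 :=
  (ι.toLinearEquiv.symm : GroupLieAlgebra 𝓘(ℂ, E) G ≃ₗ[ℂ] 𝔤)

/-- Left-invariant fields are holomorphic, trivialise the tangent bundle, and bracket as in the Lie
algebra; all three properties survive pullback along the inverse chart, which is a local
diffeomorphism. -/
theorem isLieFrame_chartFrame [CompleteSpace E] [FiniteDimensional ℂ E]
    (ι : 𝔤 ≃ₗ⁅ℂ⁆ GroupLieAlgebra 𝓘(ℂ, E) G) :
    IsLieFrame (modelEquiv ι) (chartFrame E G) (chartDomain E G) where
  isOpen := isOpen_chartDomain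
  contDiffOn := by
    rw [contDiffOn_clm_apply]
    intro v y hy
    exact (contDiffAt_mpullback_chartInv hy
      (contMDiff_omega_mulInvariantVectorField _ _)).contDiffWithinAt
  isInvertible y hy := by
    have h₁ : ((mfderiv 𝓘(ℂ, E) 𝓘(ℂ, E) (chartInv E G) y).inverse : E →L[ℂ] E).IsInvertible :=
      (isInvertible_mfderiv_chartInv hy).inverse
    exact h₁.comp (isInvertible_mfderiv_mul_left (E := E) (chartInv E G y))
  lie y hy a b := by
    let a' : GroupLieAlgebra 𝓘(ℂ, E) G := a
    let b' : GroupLieAlgebra 𝓘(ℂ, E) G := b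
    have h₁ := mpullback_chartInv_mlieBracket hy (contMDiff_omega_mulInvariantVectorField a' _)
      (contMDiff_omega_mulInvariantVectorField b' _)
    rw [← mulInvariantVector_mlieBracket, ← GroupLieAlgebra.bracket_def] at h₁
    have h₂ : ι ⁅ι.symm a', ι.symm b'⁆ = ⁅a', b'⁆ := by
      rw [LieEquiv.map_lie, LieEquiv.apply_symm_apply, LieEquiv.apply_symm_apply]
    rw [← h₂] at h₁
    exact h₁.symm

end LieGroupFrame

/-! ### Twisted derivations and brackets in a Lie frame. -/

section Symmetries

open VectorField

variable {𝔤 : Type*} [LieRing 𝔤] [LieAlgebra ℂ 𝔤]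

/-- `D` is a derivation of `𝔤` twisted by the character `φ`. Equivalently, the bracket of `𝔤`
extends to `𝔤 ⊕ ℂ` by an element acting through `D` modulo itself. -/
structure IsTwistedDerivation (D : 𝔤 →ₗ[ℂ] 𝔤) (φ : 𝔤 →ₗ[ℂ] ℂ) : Prop where
  map_lie : ∀ x y, D ⁅x, y⁆ = ⁅D x, y⁆ + ⁅x, D y⁆ + φ y • D x - φ x • D y
  char_lie : ∀ x y : 𝔤, φ ⁅x, y⁆ = 0

variable {E : Type*} [NormedAddCommGroup E] [NormedSpace ℂ E]

/-- The representation of `𝔤` on `𝔤 ⊕ ℂ` given by a twisted derivation, with `𝔤` replaced by the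
vector space `E` via `κ`. -/
@[reducible]
def IsTwistedDerivation.lieRingModule {D : 𝔤 →ₗ[ℂ] 𝔤} {φ : 𝔤 →ₗ[ℂ] ℂ}
    (h : IsTwistedDerivation D φ) (κ : E ≃ₗ[ℂ] 𝔤) : LieRingModule 𝔤 (E × ℂ) where
  bracket v p := (κ.symm (⁅v, κ p.1⁆ + p.2 • D v), p.2 * φ v)
  add_lie x y p := by
    ext
    · simp only [add_lie, map_add, smul_add, Prod.mk_add_mk]; abel
    · simp; ring
  lie_add x p q := by
    ext
    · simp only [lie_add, map_add, Prod.fst_add, Prod.snd_add, add_smul, Prod.mk_add_mk]; abel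
    · simp; ring
  leibniz_lie x y p := by
    ext
    · simp only [Prod.mk_add_mk]
      rw [← map_add]
      congr 1
      simp only [LinearEquiv.apply_symm_apply, h.map_lie, lie_add, lie_smul, lie_lie, mul_smul,
        smul_add, smul_sub]
      rw [← lie_skew (D x) y]
      simp only [smul_neg]
      abel
    · simp [h.char_lie]; ring

theorem IsTwistedDerivation.lieModule {D : 𝔤 →ₗ[ℂ] 𝔤} {φ : 𝔤 →ₗ[ℂ] ℂ}
    (h : IsTwistedDerivation D φ) (κ : E ≃ₗ[ℂ] 𝔤) :
    @LieModule ℂ 𝔤 (E × ℂ) _ _ _ _ _ (h.lieRingModule κ) :=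
  letI := h.lieRingModule κ
  { smul_lie := fun t x p => by
      ext
      · simp [Bracket.bracket, smul_comm t]
      · simp [Bracket.bracket]; ring
    lie_smul := fun t x p => by
      ext
      · simp [Bracket.bracket, mul_smul]
      · simp [Bracket.bracket]; ring }

/-- Any functional killing `T` is constant along `b` near `y`, so it kills the derivative;
functionals separate `T` from outside vectors. -/
theorem HasFDerivAt.apply_mem_of_eventually_mem {F : Type*} [NormedAddCommGroup F]
    [NormedSpace ℂ F] [FiniteDimensional ℂ F] {b : E → F} {b' : E →L[ℂ] F} {y : E}
    (hb : HasFDerivAt b b' y) (T : Submodule ℂ F) (h : ∀ᶠ z in 𝓝 y, b z ∈ T) (x : E) :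
    b' x ∈ T := by
  by_contra hx
  obtain ⟨l, hl, hlT⟩ := Submodule.exists_le_ker_of_notMem hx
  have h1 := (LinearMap.toContinuousLinearMap l).hasFDerivAt.comp y hb
  have h2 : (fun z => LinearMap.toContinuousLinearMap l (b z)) =ᶠ[𝓝 y] fun _ => 0 :=
    h.mono fun z hz => hlT hz
  have h3 := (h1.congr_of_eventuallyEq h2.symm).unique (hasFDerivAt_const (0 : ℂ) y)
  exact hl (DFunLike.congr_fun h3 x)

/-- The bracket of two vector fields written in a Lie frame. -/
theorem IsLieFrame.lieBracket_apply {κ : E ≃ₗ[ℂ] 𝔤} {V : E → E →L[ℂ] E} {U : Set E}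
    (hV : IsLieFrame κ V U) {y : E} (hy : y ∈ U) {a b : E → E} {a' b' : E →L[ℂ] E}
    (ha : HasFDerivAt a a' y) (hb : HasFDerivAt b b' y) :
    lieBracket ℂ (fun z => V z (a z)) (fun z => V z (b z)) y =
      V y (κ.symm ⁅κ (a y), κ (b y)⁆ + b' (V y (a y)) - a' (V y (b y))) := by
  rw [lieBracket_eq]
  have h1 := ((hV.hasFDerivAt hy).clm_apply ha).fderiv
  have h2 := ((hV.hasFDerivAt hy).clm_apply hb).fderiv
  have h3 := hV.fderiv_sub_fderiv hy (a y) (b y)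
  simp only [h1, h2, map_add, map_sub, ← h3]
  simp
  abel

end Symmetries

/-! ### Vector fields given by their left-invariant components. -/

section SymmetryGerms

open VectorField

variable {𝔤 : Type*} [LieRing 𝔤] [LieAlgebra ℂ 𝔤]
  {E : Type*} [NormedAddCommGroup E] [NormedSpace ℂ E]
  {G : Type*} [TopologicalSpace G] [ChartedSpace E G] [Group G]

/-- The vector field on `G` with components `a` in the left-invariant frame, where `a` is given in
the chart at the identity. -/
noncomputable def frameField (G : Type*) [TopologicalSpace G] [ChartedSpace E G] [Group G]
    (a : E → E) (x : G) : TangentSpace 𝓘(ℂ, E) x :=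
  mulInvariantVectorField (a (extChartAt 𝓘(ℂ, E) (1 : G) x) : GroupLieAlgebra 𝓘(ℂ, E) G) x

theorem mpullback_frameField (a : E → E) {y : E} (hy : y ∈ chartDomain E G) :
    mpullback 𝓘(ℂ, E) 𝓘(ℂ, E) (chartInv E G) (frameField G a) y = chartFrame E G y (a y) := by
  have h : extChartAt 𝓘(ℂ, E) (1 : G) (chartInv E G y) = y :=
    (extChartAt 𝓘(ℂ, E) (1 : G)).right_inv hy
  rw [mpullback_apply, frameField, h]
  rfl

variable [LieGroup 𝓘(ℂ, E) ω G]

/-- In a basis of `E` the field is a finite combination of left-invariant fields with holomorphic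
coefficients. -/
theorem holomorphicVectorFieldAt_frameField [FiniteDimensional ℂ E] {a : E → E} {q : G}
    (hq : q ∈ (extChartAt 𝓘(ℂ, E) (1 : G)).source)
    (ha : ContDiffAt ℂ ω a (extChartAt 𝓘(ℂ, E) (1 : G) q)) :
    HolomorphicVectorFieldAt (frameField G a) q := by
  let B := Module.finBasis ℂ E
  let c : Fin _ → E →L[ℂ] ℂ := fun i => LinearMap.toContinuousLinearMap (B.coord i)
  let f : Fin _ → G → ℂ := fun i x => c i (a (extChartAt 𝓘(ℂ, E) (1 : G) x))
  have hf : ∀ i, ContMDiffAt 𝓘(ℂ, E) 𝓘(ℂ, ℂ) ω (f i) q := by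
    intro i
    have h1 : ContDiffAt ℂ ω (fun y => c i (a y)) (extChartAt 𝓘(ℂ, E) (1 : G) q) :=
      (c i).contDiff.contDiffAt.comp _ ha
    exact h1.contMDiffAt.comp q (contMDiffAt_extChartAt' (by simpa using hq))
  have hsum := ContMDiffAt.sum_section (s := Finset.univ) (x₀ := q)
    (t := fun i x => f i x • mulInvariantVectorField (B i : GroupLieAlgebra 𝓘(ℂ, E) G) x)
    fun i _ => (hf i).smul_section (contMDiff_omega_mulInvariantVectorField
      (B i : GroupLieAlgebra 𝓘(ℂ, E) G) q)
  refine hsum.congr_of_eventuallyEq (Filter.Eventually.of_forall fun x => ?_)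
  have h2 : frameField G a x =
      ∑ i, f i x • mulInvariantVectorField (B i : GroupLieAlgebra 𝓘(ℂ, E) G) x := by
    let L : E →L[ℂ] E := mfderiv 𝓘(ℂ, E) 𝓘(ℂ, E) (fun h : G => x * h) 1
    show L (a (extChartAt 𝓘(ℂ, E) (1 : G) x)) = ∑ i, f i x • L (B i)
    conv_lhs => rw [← B.sum_repr (a (extChartAt 𝓘(ℂ, E) (1 : G) x)), map_sum]
    refine Finset.sum_congr rfl fun i _ => ?_
    rw [map_smul]
    rfl
  exact congrArg (fun v => (⟨x, v⟩ : TangentBundle 𝓘(ℂ, E) G)) h2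

variable [CompleteSpace E] [FiniteDimensional ℂ E]

/-- If the components `a` of a vector field satisfy the infinitesimal symmetry equation in the
directions of the subspace `S`, then the vector field preserves the left-invariant distribution
determined by `S`. -/
theorem preservesDistributionAt_frameField (ι : 𝔤 ≃ₗ⁅ℂ⁆ GroupLieAlgebra 𝓘(ℂ, E) G)
    {a : E → E} {y : E} (hy : y ∈ chartDomain E G) (ha : ContDiffAt ℂ ω a y)
    (S : Submodule ℂ 𝔤)
    (hS : ∀ b, modelEquiv ι b ∈ S →
      ⁅modelEquiv ι (a y), modelEquiv ι b⁆ - modelEquiv ι (fderiv ℂ a y (chartFrame E G y b)) ∈ S) :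
    PreservesDistributionAt (leftInvariantDistribution (S.map ι.toLinearEquiv.toLinearMap))
      (frameField G a) (chartInv E G y) := by
  intro Y hY hYD
  have hV := isLieFrame_chartFrame ι
  set V := chartFrame E G with hVdef
  set κ := modelEquiv ι with hκ
  set Y' : E → E := mpullback 𝓘(ℂ, E) 𝓘(ℂ, E) (chartInv E G) Y with hY'
  have hY's : ContDiffAt ℂ ω Y' y := contDiffAt_mpullback_chartInv hy hY
  set b : E → E := fun z => (V z).inverse (Y' z) with hb
  have hbs : ContDiffAt ℂ ω b y := by
    obtain ⟨e, he⟩ := hV.isInvertible y hy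
    have := contDiffAt_map_inverse (n := ω) e
    rw [he] at this
    exact (ContDiffAt.comp (f := V) y this (hV.contDiffAt hy)).clm_apply hY's
  have hcont : Filter.Tendsto (chartInv E G) (𝓝 y) (𝓝 (chartInv E G y)) :=
    (contMDiffAt_chartInv hy).continuousAt
  have hev : ∀ᶠ z in 𝓝 y, κ (b z) ∈ S ∧ Y' z = V z (b z) := by
    filter_upwards [hcont.eventually hYD, isOpen_chartDomain.mem_nhds hy] with z hz hzU
    obtain ⟨_, ⟨s, hs, rfl⟩, hv⟩ := hz
    have h1 : Y' z = V z (κ.symm s) := by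
      rw [hY', mpullback_apply, ← hv]
      rfl
    have h2 : b z = κ.symm s := by
      obtain ⟨e, he⟩ := hV.isInvertible z hzU
      rw [hb]
      simp only [h1, ← he]
      simp
    rw [h2, ← h1]
    exact ⟨by simpa using hs, rfl⟩
  have hbd := (hbs.differentiableAt (by simp)).hasFDerivAt
  have had := (ha.differentiableAt (by simp)).hasFDerivAt
  have hsrc : chartInv E G y ∈ (extChartAt 𝓘(ℂ, E) (1 : G)).source :=
    (extChartAt 𝓘(ℂ, E) (1 : G)).map_target hy
  have hhol : HolomorphicVectorFieldAt (frameField G a) (chartInv E G y) := by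
    refine holomorphicVectorFieldAt_frameField hsrc ?_
    rwa [(extChartAt 𝓘(ℂ, E) (1 : G)).right_inv hy]
  have hbr := mpullback_chartInv_mlieBracket hy hhol hY
  have hX' : (mpullback 𝓘(ℂ, E) 𝓘(ℂ, E) (chartInv E G) (frameField G a) : E → E)
      =ᶠ[𝓝 y] fun z => V z (a z) :=
    Filter.eventually_of_mem (isOpen_chartDomain.mem_nhds hy) fun z hz => mpullback_frameField a hz
  have hY'e : Y' =ᶠ[𝓝 y] fun z => V z (b z) := hev.mono fun z hz => hz.2
  have hbr2 := hX'.lieBracket_vectorField_eq (𝕜 := ℂ) hY'e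
  rw [hV.lieBracket_apply hy had hbd] at hbr2
  -- The frame components of the bracket. The derivative of `b` stays in `S` because `b` does; the
  -- other two terms together are in `S` by `hS`.
  set s : E := κ.symm ⁅κ (a y), κ (b y)⁆ + fderiv ℂ b y (V y (a y)) - fderiv ℂ a y (V y (b y))
    with hs
  have hsS : κ s ∈ S := by
    have h1 : κ (fderiv ℂ b y (V y (a y))) ∈ S :=
      hbd.apply_mem_of_eventually_mem (S.comap κ.toLinearMap) (hev.mono fun z hz => hz.1) _
    have h2 := hS (b y) hev.self_of_nhds.1
    have h3 : κ s = (⁅κ (a y), κ (b y)⁆ - κ (fderiv ℂ a y (V y (b y))))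
        + κ (fderiv ℂ b y (V y (a y))) := by
      rw [hs, map_sub, map_add, LinearEquiv.apply_symm_apply]
      abel
    rw [h3]
    exact add_mem h2 h1
  refine ⟨(s : GroupLieAlgebra 𝓘(ℂ, E) G), ⟨κ s, hsS, ?_⟩, ?_⟩
  · exact κ.symm_apply_apply s
  · have h1 : (mfderiv 𝓘(ℂ, E) 𝓘(ℂ, E) (chartInv E G) y).inverse
        (mlieBracket 𝓘(ℂ, E) (frameField G a) Y (chartInv E G y)) =
        (mfderiv 𝓘(ℂ, E) 𝓘(ℂ, E) (chartInv E G) y).inverse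
        (mulInvariantVectorField (s : GroupLieAlgebra 𝓘(ℂ, E) G) (chartInv E G y)) :=
      hbr.trans hbr2
    obtain ⟨e, he⟩ := isInvertible_mfderiv_chartInv hy
    rw [← he, ContinuousLinearMap.inverse_equiv] at h1
    exact (e.symm.injective h1).symm

end SymmetryGerms

/-! ### Six independent symmetries from a twisted derivation. -/

section LowerBound

open VectorField

variable {𝔤 : Type*} [LieRing 𝔤] [LieAlgebra ℂ 𝔤]
  {E : Type*} [NormedAddCommGroup E] [NormedSpace ℂ E]
  {G : Type*} [TopologicalSpace G] [ChartedSpace E G] [Group G] [LieGroup 𝓘(ℂ, E) ω G]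

theorem frameField_eq_zero_iff (a : E → E) (x : G) :
    frameField G a x = 0 ↔ a (extChartAt 𝓘(ℂ, E) (1 : G) x) = 0 := by
  obtain ⟨e, he⟩ := isInvertible_mfderiv_mul_left (E := E) x
  show mfderiv 𝓘(ℂ, E) 𝓘(ℂ, E) (fun h : G => x * h) 1
    (a (extChartAt 𝓘(ℂ, E) (1 : G) x) : GroupLieAlgebra 𝓘(ℂ, E) G) = 0 ↔ _
  rw [← he]
  exact e.map_eq_zero_iff

/-- A nonzero twisted derivation that preserves both subalgebras yields, besides the
five-dimensional space of right-invariant fields, a further infinitesimal symmetry. -/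
theorem six_le_ilcSymDim [CompleteSpace E] [LieAlgebra.IsSolvable 𝔤] (hfin : Module.finrank ℂ 𝔤 = 5)
    (ι : 𝔤 ≃ₗ⁅ℂ⁆ GroupLieAlgebra 𝓘(ℂ, E) G) (𝔢 𝔣 : LieSubalgebra ℂ 𝔤)
    {D : 𝔤 →ₗ[ℂ] 𝔤} {φ : 𝔤 →ₗ[ℂ] ℂ} (hD : IsTwistedDerivation D φ) (hD0 : D ≠ 0)
    (h𝔢 : ∀ x ∈ 𝔢, D x ∈ 𝔢) (h𝔣 : ∀ x ∈ 𝔣, D x ∈ 𝔣) : 6 ≤ ilcSymDim ι 𝔢 𝔣 := by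
  have : Module.Finite ℂ 𝔤 := Module.finite_of_finrank_pos (by omega)
  set κ := modelEquiv ι with hκ
  have : FiniteDimensional ℂ E := Module.Finite.equiv κ.symm
  have hfinE : Module.finrank ℂ E = 5 := by rw [κ.finrank_eq, hfin]
  let _ := hD.lieRingModule κ
  have := hD.lieModule κ
  have hlie : ∀ (v : 𝔤) (p : E × ℂ), ⁅v, p⁆ = (κ.symm (⁅v, κ p.1⁆ + p.2 • D v), p.2 * φ v) :=
    fun _ _ => rfl
  have hV := isLieFrame_chartFrame ι
  set V := chartFrame E G with hVdef
  set y₀ : E := extChartAt 𝓘(ℂ, E) (1 : G) 1 with hy₀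
  have hy₀U : y₀ ∈ chartDomain E G := mem_extChartAt_target 1
  have hW : Module.finrank ℂ (E × ℂ) = 6 := by simp [hfinE]
  let B : Module.Basis (Fin 6) ℂ (E × ℂ) := Module.finBasisOfFinrankEq ℂ _ hW
  choose U hUsub hUo hyU Ξ hΞ hΞ0 hΞV using fun i => hV.exists_equivariant hy₀U (B i)
  have hcont : Filter.Tendsto (extChartAt 𝓘(ℂ, E) (1 : G)) (𝓝 1) (𝓝 y₀) :=
    continuousAt_extChartAt 1
  have hfst : ∀ i, ∀ y ∈ U i, ContDiffAt ℂ ω (fun y => (Ξ i y).1) y := fun i y hy =>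
    ((hΞ i).contDiffAt ((hUo i).mem_nhds hy)).fst
  have hdΞ : ∀ i, ∀ y ∈ U i, HasFDerivAt (Ξ i) (fderiv ℂ (Ξ i) y) y := fun i y hy =>
    (((hΞ i).contDiffAt ((hUo i).mem_nhds hy)).differentiableAt (by simp)).hasFDerivAt
  have hpres : ∀ i, ∀ y ∈ U i, ∀ S : Submodule ℂ 𝔤, (∀ x ∈ S, D x ∈ S) →
      PreservesDistributionAt (leftInvariantDistribution (S.map ι.toLinearEquiv.toLinearMap))
        (frameField G fun y => (Ξ i y).1) (chartInv E G y) := by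
    intro i y hy S hS
    refine preservesDistributionAt_frameField ι (hUsub i hy) (hfst i y hy) S fun b hb => ?_
    rw [(hdΞ i y hy).fst.fderiv]
    have h1 : (ContinuousLinearMap.fst ℂ E ℂ ∘SL fderiv ℂ (Ξ i) y) (chartFrame E G y b)
        = (fderiv ℂ (Ξ i) y (V y b)).1 := rfl
    rw [h1, hΞV i y hy b, hlie, Prod.fst_neg, map_neg]
    simp only [← hκ, LinearEquiv.apply_symm_apply]
    -- The two adjoint terms cancel and only `t • D b` remains, `t` being the second component of `Ξ
    -- i y`; this is where invariance of `S` under `D` enters.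
    rw [← lie_skew, sub_neg_eq_add, neg_add_cancel_left]
    exact S.smul_mem _ (hS _ hb)
  have hsym : ∀ i, frameField G (fun y => (Ξ i y).1) ∈ localSymmetries
      (leftInvariantDistribution (G := G) (𝔢.toSubmodule.map ι.toLinearEquiv.toLinearMap))
      (leftInvariantDistribution (G := G) (𝔣.toSubmodule.map ι.toLinearEquiv.toLinearMap)) 1 := by
    intro i
    filter_upwards [extChartAt_source_mem_nhds (I := 𝓘(ℂ, E)) (1 : G),
      hcont.eventually ((hUo i).mem_nhds (hyU i))] with q hq hqU
    have hq' : chartInv E G (extChartAt 𝓘(ℂ, E) (1 : G) q) = q :=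
      (extChartAt 𝓘(ℂ, E) (1 : G)).left_inv hq
    refine ⟨holomorphicVectorFieldAt_frameField hq (hfst i _ hqU), ?_, ?_⟩
    · have := hpres i _ hqU 𝔢.toSubmodule h𝔢
      rwa [hq'] at this
    · have := hpres i _ hqU 𝔣.toSubmodule h𝔣
      rwa [hq'] at this
  let γ : Fin 6 → SymmetryGerms
      (leftInvariantDistribution (G := G) (𝔢.toSubmodule.map ι.toLinearEquiv.toLinearMap))
      (leftInvariantDistribution (G := G) (𝔣.toSubmodule.map ι.toLinearEquiv.toLinearMap)) 1 :=
    fun i => Submodule.Quotient.mk ⟨_, hsym i⟩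
  have hγ : LinearIndependent ℂ γ := by
    rw [Fintype.linearIndependent_iff]
    intro c hc
    let Θ : E → E × ℂ := fun y => ∑ i, c i • Ξ i y
    have hfield : ∀ q, (∑ i, c i • frameField G (fun y => (Ξ i y).1)) q
        = frameField G (fun y => (Θ y).1) q := by
      intro q
      let L : E →L[ℂ] E := mfderiv 𝓘(ℂ, E) 𝓘(ℂ, E) (fun h : G => q * h) 1
      have h1 : frameField G (fun y => (Θ y).1) q
          = L (∑ i, c i • (Ξ i (extChartAt 𝓘(ℂ, E) (1 : G) q)).1) := by
        have : (Θ (extChartAt 𝓘(ℂ, E) (1 : G) q)).1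
          = ∑ i, c i • (Ξ i (extChartAt 𝓘(ℂ, E) (1 : G) q)).1 := by simp [Θ, Prod.fst_sum]
        rw [← this]
        rfl
      rw [h1, map_sum]
      simp only [map_smul, Finset.sum_apply]
      rfl
    have hvan : ∀ᶠ q in 𝓝 (1 : G), (Θ (extChartAt 𝓘(ℂ, E) (1 : G) q)).1 = 0 := by
      have h1 : (Submodule.Quotient.mk (∑ i, c i • (⟨_, hsym i⟩ : localSymmetries
          (leftInvariantDistribution (G := G) (𝔢.toSubmodule.map ι.toLinearEquiv.toLinearMap))
          (leftInvariantDistribution (G := G) (𝔣.toSubmodule.map ι.toLinearEquiv.toLinearMap))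
          1)) : SymmetryGerms _ _ (1 : G)) = 0 := by
        rw [← hc]
        exact map_sum (Submodule.mkQ _) _ _
      rw [Submodule.Quotient.mk_eq_zero, Submodule.mem_comap] at h1
      have h2 : ∀ᶠ q in 𝓝 (1 : G), (∑ i, c i • frameField G (fun y => (Ξ i y).1)) q = 0 := by
        have : (∑ i, c i • frameField G (fun y => (Ξ i y).1)) ∈ vanishingNear (E := E) (1 : G) := by
          simpa using h1
        exact this
      filter_upwards [h2] with q hq
      rw [hfield, frameField_eq_zero_iff] at hq
      exact hq
    have hvan' : ∀ᶠ y in 𝓝 y₀, (Θ y).1 = 0 := by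
      have h1 : Filter.Tendsto (chartInv E G) (𝓝 y₀) (𝓝 1) := by
        have := (contMDiffAt_chartInv (G := G) hy₀U).continuousAt
        rwa [ContinuousAt, show chartInv E G y₀ = 1 from extChartAt_to_inv 1] at this
      filter_upwards [h1.eventually hvan, isOpen_chartDomain.mem_nhds hy₀U] with y hy hyU
      rwa [(extChartAt 𝓘(ℂ, E) (1 : G)).right_inv hyU] at hy
    have hΘ0 : Θ y₀ = ∑ i, c i • B i := by simp [Θ, hΞ0]
    have hΘd : HasFDerivAt Θ (∑ i, c i • fderiv ℂ (Ξ i) y₀) y₀ :=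
      HasFDerivAt.fun_sum fun i _ => (hdΞ i y₀ (hyU i)).const_smul (c i)
    have hΘV : ∀ a, (∑ i, c i • fderiv ℂ (Ξ i) y₀) (V y₀ a) = - ⁅κ a, Θ y₀⁆ := by
      intro a
      have h1 : ⁅κ a, Θ y₀⁆ = ∑ i, c i • ⁅κ a, Ξ i y₀⁆ := by
        have := map_sum (LieModule.toEnd ℂ 𝔤 (E × ℂ) (κ a)) (fun i => c i • Ξ i y₀) Finset.univ
        simpa only [map_smul, LieModule.toEnd_apply_apply] using this
      rw [h1]
      simp [hΞV _ y₀ (hyU _), ← hκ]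
    have hzero : (Θ y₀).1 = 0 := hvan'.self_of_nhds
    have hd0 : ∀ a, (⁅κ a, Θ y₀⁆).1 = 0 := by
      intro a
      have h1 := hΘd.fst.congr_of_eventuallyEq
        (f₁ := fun _ => (0 : E)) (hvan'.mono fun y hy => hy.symm)
      have h2 := DFunLike.congr_fun (h1.unique (hasFDerivAt_const (0 : E) y₀)) (V y₀ a)
      have h3 : ((∑ i, c i • fderiv ℂ (Ξ i) y₀) (V y₀ a)).1 = 0 := h2
      rw [hΘV, Prod.fst_neg, neg_eq_zero] at h3
      exact h3
    -- At a point where the first component vanishes to first order the equation reads `t • D v = 0`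
    -- for every `v`, and `D ≠ 0`.
    have hsnd : (Θ y₀).2 = 0 := by
      by_contra hne
      refine hD0 (LinearMap.ext fun v => ?_)
      have h1 := hd0 (κ.symm v)
      rw [hlie] at h1
      simp only [hzero, map_zero, lie_zero, zero_add, LinearEquiv.apply_symm_apply,
        EmbeddingLike.map_eq_zero_iff] at h1
      exact (smul_eq_zero.1 h1).resolve_left hne
    have hall : ∑ i, c i • B i = 0 := by
      rw [← hΘ0]
      exact Prod.ext hzero hsnd
    exact Fintype.linearIndependent_iff.1 B.linearIndependent c hall
  rw [ilcSymDim]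
  simpa using hγ.cardinal_lift_le_rank

end LowerBound

/-! ### Linear algebra of planes and conjugate-linear involutions. -/

section LinearAlgebra

variable {V : Type*} [AddCommGroup V] [Module ℂ V]

/-- Two subspaces of total dimension exceeding that of the ambient space meet nontrivially. -/
theorem Submodule.exists_mem_inf_ne_zero [FiniteDimensional ℂ V] {S N : Submodule ℂ V}
    (h : Module.finrank ℂ V < Module.finrank ℂ S + Module.finrank ℂ N) :
    ∃ x ∈ S, x ∈ N ∧ x ≠ 0 := by
  have h1 := Submodule.finrank_sup_add_finrank_inf_eq S N
  have h2 := Submodule.finrank_le (S ⊔ N)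
  have h3 : S ⊓ N ≠ ⊥ := by
    intro h4
    rw [h4, finrank_bot] at h1
    omega
  obtain ⟨x, hx, hx0⟩ := (Submodule.ne_bot_iff _).1 h3
  exact ⟨x, hx.1, hx.2, hx0⟩

/-- In a two-dimensional space, a nonzero vector of a subspace `N` and a vector outside `N` form a
basis. -/
theorem Submodule.exists_eq_smul_add_smul {S N : Submodule ℂ V}
    (hS : Module.finrank ℂ S = 2) {x y : V} (hx : x ∈ S) (hxN : x ∈ N) (hx0 : x ≠ 0) (hy : y ∈ S)
    (hyN : y ∉ N) {w : V} (hw : w ∈ S) : ∃ s t : ℂ, w = s • x + t • y := by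
  have : FiniteDimensional ℂ S := Module.finite_of_finrank_pos (by omega)
  have hli : LinearIndependent ℂ ![x, y] := by
    rw [LinearIndependent.pair_iff' hx0]
    rintro a rfl
    exact hyN (N.smul_mem a hxN)
  have hle : Submodule.span ℂ {x, y} ≤ S := by
    rw [Submodule.span_le]
    rintro v (rfl | rfl) <;> assumption
  have heq : Submodule.span ℂ {x, y} = S := by
    refine Submodule.eq_of_le_of_finrank_eq hle ?_
    have := finrank_span_eq_card hli
    rw [Matrix.range_cons, Matrix.range_cons, Matrix.range_empty, Set.union_empty,
      Set.singleton_union] at this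
    simpa [hS] using this
  rw [← heq, Submodule.mem_span_pair] at hw
  obtain ⟨s, t, h⟩ := hw
  exact ⟨s, t, h.symm⟩

theorem Submodule.exists_eq_smul_of_mem_inf {S N : Submodule ℂ V}
    (hS : Module.finrank ℂ S = 2) {x y : V} (hx : x ∈ S) (hxN : x ∈ N) (hx0 : x ≠ 0) (hy : y ∈ S)
    (hyN : y ∉ N) {w : V} (hw : w ∈ S) (hwN : w ∈ N) : ∃ s : ℂ, w = s • x := by
  obtain ⟨s, t, rfl⟩ := Submodule.exists_eq_smul_add_smul hS hx hxN hx0 hy hyN hw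
  have ht : t • y ∈ N := (Submodule.add_mem_iff_right N (N.smul_mem s hxN)).1 hwN
  by_cases h0 : t = 0
  · exact ⟨s, by simp [h0]⟩
  · exact absurd ((N.smul_mem_iff h0).1 ht) hyN

/-- A semilinear bijection over an automorphism of the scalars preserves rank. -/
theorem Submodule.finrank_map_conj {τ : V →ₛₗ[starRingEnd ℂ] V} (hτ : Function.Involutive τ)
    (S : Submodule ℂ V) : Module.finrank ℂ (S.map τ) = Module.finrank ℂ S := by
  let j : S ≃+ S.map τ :=
    { toFun := fun x => ⟨τ x, Submodule.mem_map_of_mem x.2⟩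
      invFun := fun x => ⟨τ x, by
        obtain ⟨y, hy, h⟩ := x.2
        rw [← h, hτ y]
        exact hy⟩
      left_inv := fun x => Subtype.ext (hτ x)
      right_inv := fun x => Subtype.ext (hτ x)
      map_add' := fun x y => Subtype.ext (map_add τ _ _) }
  have := rank_eq_of_equiv_equiv (starRingEnd ℂ) j (starRingAut (R := ℂ)).bijective
    (fun r m => Subtype.ext (map_smulₛₗ τ r (m : V)))
  rw [Module.finrank, Module.finrank, this]

end LinearAlgebra

/-! ### Solvability, and bases adapted to an ILC triple. -/

section LieAlgebra

variable {𝔤 : Type*} [LieRing 𝔤] [LieAlgebra ℂ 𝔤]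

/-- A Lie algebra with an abelian ideal of codimension two is solvable. -/
theorem LieAlgebra.isSolvable_of_codim_two [FiniteDimensional ℂ 𝔤] (𝔞 : LieIdeal ℂ 𝔤)
    (h𝔞 : ∀ x ∈ 𝔞, ∀ y ∈ 𝔞, ⁅x, y⁆ = 0)
    (hdim : Module.finrank ℂ 𝔤 = Module.finrank ℂ 𝔞 + 2) : LieAlgebra.IsSolvable 𝔤 := by
  obtain ⟨Q, hQ⟩ := 𝔞.toSubmodule.exists_isCompl
  have hQ2 : Module.finrank ℂ Q = 2 := by
    have h1 := Submodule.finrank_add_eq_of_isCompl hQ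
    have h2 : Module.finrank ℂ 𝔞.toSubmodule = Module.finrank ℂ 𝔞 := rfl
    omega
  let B : Module.Basis (Fin 2) ℂ Q := Module.finBasisOfFinrankEq ℂ Q hQ2
  set p : 𝔤 := ((B 0 : Q) : 𝔤)
  set q : 𝔤 := ((B 1 : Q) : 𝔤)
  have hdec : ∀ x : 𝔤, ∃ a ∈ 𝔞, ∃ s t : ℂ, x = a + s • p + t • q := by
    intro x
    have hx : x ∈ 𝔞.toSubmodule ⊔ Q := hQ.sup_eq_top ▸ Submodule.mem_top
    obtain ⟨a, ha, w, hw, rfl⟩ := Submodule.mem_sup.1 hx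
    refine ⟨a, ha, B.repr ⟨w, hw⟩ 0, B.repr ⟨w, hw⟩ 1, ?_⟩
    have := congrArg (Subtype.val) (B.sum_repr ⟨w, hw⟩)
    rw [Fin.sum_univ_two] at this
    rw [add_assoc]
    congr 1
    exact this.symm
  have hbr : ∀ x y : 𝔤, ∃ a ∈ 𝔞, ∃ s : ℂ, ⁅x, y⁆ = a + s • ⁅p, q⁆ := by
    intro x y
    obtain ⟨a, ha, s, t, rfl⟩ := hdec x
    obtain ⟨a', ha', s', t', rfl⟩ := hdec y
    refine ⟨⁅a, a' + s' • p + t' • q⁆ + ⁅s • p + t • q, a'⁆,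
      add_mem (lie_mem_left ℂ 𝔤 𝔞 _ _ ha) (lie_mem_right ℂ 𝔤 𝔞 _ _ ha'), s * t' - t * s', ?_⟩
    simp only [add_lie, lie_add, smul_lie, lie_smul, lie_self]
    rw [← lie_skew p q]
    module
  -- Modulo `𝔞` every bracket is a multiple of `⁅p, q⁆`, so the derived algebra lies in `J`.
  -- Brackets within `J` fall back into `𝔞`, which is abelian: three derivations suffice.
  let J : LieIdeal ℂ 𝔤 :=
    { 𝔞.toSubmodule ⊔ Submodule.span ℂ {⁅p, q⁆} with
      lie_mem := by
        intro x m _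
        obtain ⟨a, ha, s, h⟩ := hbr x m
        change ⁅x, m⁆ ∈ 𝔞.toSubmodule ⊔ Submodule.span ℂ {⁅p, q⁆}
        rw [h]
        exact Submodule.add_mem_sup ha (Submodule.smul_mem _ _ (Submodule.mem_span_singleton_self _)) }
  have h1 : LieAlgebra.derivedSeries ℂ 𝔤 1 ≤ J := by
    rw [LieAlgebra.derivedSeries_def, LieAlgebra.derivedSeriesOfIdeal_succ,
      LieAlgebra.derivedSeriesOfIdeal_zero, LieSubmodule.lie_le_iff]
    intro x _ y _
    obtain ⟨a, ha, s, h⟩ := hbr x y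
    rw [h]
    exact Submodule.add_mem_sup ha (Submodule.smul_mem _ _ (Submodule.mem_span_singleton_self _))
  have h2 : LieAlgebra.derivedSeries ℂ 𝔤 2 ≤ 𝔞 := by
    rw [LieAlgebra.derivedSeries_def, LieAlgebra.derivedSeriesOfIdeal_succ, LieSubmodule.lie_le_iff]
    intro x hx y hy
    obtain ⟨a, ha, w, hw, rfl⟩ := Submodule.mem_sup.1 (h1 hx)
    obtain ⟨a', ha', w', hw', rfl⟩ := Submodule.mem_sup.1 (h1 hy)
    obtain ⟨s, rfl⟩ := Submodule.mem_span_singleton.1 hw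
    obtain ⟨t, rfl⟩ := Submodule.mem_span_singleton.1 hw'
    have : ⁅a + s • ⁅p, q⁆, a' + t • ⁅p, q⁆⁆ = ⁅a, a' + t • ⁅p, q⁆⁆ + ⁅s • ⁅p, q⁆, a'⁆ := by
      simp only [add_lie, lie_add, smul_lie, lie_smul, lie_self, smul_zero, add_zero]
      abel
    rw [this]
    exact add_mem (lie_mem_left ℂ 𝔤 𝔞 _ _ ha) (lie_mem_right ℂ 𝔤 𝔞 _ _ ha')
  refine LieAlgebra.IsSolvable.mk (R := ℂ) (k := 3) ?_
  rw [eq_bot_iff, LieAlgebra.derivedSeries_def, LieAlgebra.derivedSeriesOfIdeal_succ,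
    LieSubmodule.lie_le_iff]
  intro x hx y hy
  rw [h𝔞 x (h2 hx) y (h2 hy)]
  exact zero_mem _

/-- The twisted derivation property may be checked on pairs of basis vectors. -/
theorem IsTwistedDerivation.of_basis {n : ℕ} (B : Module.Basis (Fin n) ℂ 𝔤) {D : 𝔤 →ₗ[ℂ] 𝔤}
    {φ : 𝔤 →ₗ[ℂ] ℂ}
    (h : ∀ i j, i < j → D ⁅B i, B j⁆ = ⁅D (B i), B j⁆ + ⁅B i, D (B j)⁆ + φ (B j) • D (B i)
      - φ (B i) • D (B j))
    (hφ : ∀ i j, i < j → φ ⁅B i, B j⁆ = 0) : IsTwistedDerivation D φ := by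
  let br : 𝔤 →ₗ[ℂ] 𝔤 →ₗ[ℂ] 𝔤 := LieModule.toEnd ℂ 𝔤 𝔤
  have hbr : ∀ x y, br x y = ⁅x, y⁆ := fun _ _ => rfl
  have h1 : br.compr₂ D = (br.comp D) + (br.compl₂ D)
      + ((LinearMap.lsmul ℂ 𝔤).comp φ).flip.comp D
      - ((LinearMap.lsmul ℂ 𝔤).comp φ).compl₂ D := by
    refine LinearMap.ext_basis B B fun i j => ?_
    simp only [LinearMap.compr₂_apply, LinearMap.add_apply, LinearMap.sub_apply,
      LinearMap.comp_apply, LinearMap.compl₂_apply, LinearMap.flip_apply, hbr,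
      LinearMap.lsmul_apply]
    rcases lt_trichotomy i j with hij | rfl | hij
    · exact h i j hij
    · simp only [lie_self, map_zero]
      rw [← lie_skew (B i) (D (B i))]
      abel
    · rw [← lie_skew, map_neg, h j i hij, ← lie_skew (B i) (D (B j)), ← lie_skew (D (B i)) (B j)]
      abel
  have h2 : br.compr₂ φ = 0 := by
    refine LinearMap.ext_basis B B fun i j => ?_
    simp only [LinearMap.compr₂_apply, hbr, LinearMap.zero_apply]
    rcases lt_trichotomy i j with hij | rfl | hij
    · exact hφ i j hij
    · simp
    · rw [← lie_skew, map_neg, hφ j i hij, neg_zero]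
  exact ⟨fun x y => LinearMap.congr_fun₂ h1 x y, fun x y => LinearMap.congr_fun₂ h2 x y⟩

/-- There is a nonzero twisted derivation of `𝔤` that preserves `𝔢` and `𝔣`. -/
def HasTwistedDerivation (𝔢 𝔣 : LieSubalgebra ℂ 𝔤) : Prop :=
  ∃ (D : 𝔤 →ₗ[ℂ] 𝔤) (φ : 𝔤 →ₗ[ℂ] ℂ), IsTwistedDerivation D φ ∧ D ≠ 0 ∧
    (∀ x ∈ 𝔢, D x ∈ 𝔢) ∧ ∀ x ∈ 𝔣, D x ∈ 𝔣

namespace IsILCTriple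

variable {𝔢 𝔣 : LieSubalgebra ℂ 𝔤}

theorem finiteDimensional (h : IsILCTriple 𝔢 𝔣) : FiniteDimensional ℂ 𝔤 :=
  Module.finite_of_finrank_pos (by rw [h.finrank_eq]; omega)

theorem finrank_sup (h : IsILCTriple 𝔢 𝔣) :
    Module.finrank ℂ ↥(𝔢.toSubmodule ⊔ 𝔣.toSubmodule) = 4 := by
  have := h.finiteDimensional
  have h1 := Submodule.finrank_sup_add_finrank_inf_eq 𝔢.toSubmodule 𝔣.toSubmodule
  have h2 : Module.finrank ℂ 𝔢.toSubmodule = 2 := h.finrank_left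
  have h3 : Module.finrank ℂ 𝔣.toSubmodule = 2 := h.finrank_right
  rw [h.inf_eq_bot, finrank_bot] at h1
  omega

theorem eq_zero_of_mem (h : IsILCTriple 𝔢 𝔣) {x : 𝔤} (hx : x ∈ 𝔢) (hx' : x ∈ 𝔣) : x = 0 := by
  have : x ∈ 𝔢.toSubmodule ⊓ 𝔣.toSubmodule := ⟨hx, hx'⟩
  rwa [h.inf_eq_bot] at this

/-- Bases of `𝔢` and `𝔣` and a vector outside `𝔢 ⊕ 𝔣` form a basis of `𝔤`. -/
theorem exists_basis (h : IsILCTriple 𝔢 𝔣) {e₁ e₂ f₁ f₂ z : 𝔤}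
    (he : ∀ x ∈ 𝔢, ∃ s t : ℂ, x = s • e₁ + t • e₂) (hf : ∀ x ∈ 𝔣, ∃ s t : ℂ, x = s • f₁ + t • f₂)
    (hz : z ∉ 𝔢.toSubmodule ⊔ 𝔣.toSubmodule) :
    ∃ B : Module.Basis (Fin 5) ℂ 𝔤, ⇑B = ![e₁, e₂, f₁, f₂, z] := by
  have := h.finiteDimensional
  set S := Submodule.span ℂ (Set.range ![e₁, e₂, f₁, f₂, z]) with hS
  have hm : ∀ i, ![e₁, e₂, f₁, f₂, z] i ∈ S := fun i => Submodule.subset_span ⟨i, rfl⟩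
  have hC : 𝔢.toSubmodule ⊔ 𝔣.toSubmodule ≤ S := by
    refine sup_le (fun x hx => ?_) (fun x hx => ?_)
    · obtain ⟨s, t, rfl⟩ := he x hx
      exact add_mem (S.smul_mem _ (hm 0)) (S.smul_mem _ (hm 1))
    · obtain ⟨s, t, rfl⟩ := hf x hx
      exact add_mem (S.smul_mem _ (hm 2)) (S.smul_mem _ (hm 3))
  have hlt : 𝔢.toSubmodule ⊔ 𝔣.toSubmodule < S :=
    lt_of_le_of_ne hC fun heq => hz (heq ▸ hm 4)
  have h1 := Submodule.finrank_lt_finrank_of_lt hlt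
  rw [h.finrank_sup] at h1
  have h2 := Submodule.finrank_le S
  rw [h.finrank_eq] at h2
  have htop : S = ⊤ := Submodule.eq_top_of_finrank_eq (by rw [h.finrank_eq]; omega)
  exact ⟨basisOfTopLeSpanOfCardEqFinrank _ htop.ge (by simp [h.finrank_eq]),
    coe_basisOfTopLeSpanOfCardEqFinrank _ _ _⟩

end IsILCTriple

end LieAlgebra

/-! ### Explicit twisted derivations from structure constants. -/

section Cases

variable {𝔤 : Type*} [LieRing 𝔤] [LieAlgebra ℂ 𝔤]

/-- The twisted derivation property at a pair of vectors. -/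
def TwistedAt (D : 𝔤 →ₗ[ℂ] 𝔤) (φ : 𝔤 →ₗ[ℂ] ℂ) (x y : 𝔤) : Prop :=
  D ⁅x, y⁆ = ⁅D x, y⁆ + ⁅x, D y⁆ + φ y • D x - φ x • D y ∧ φ ⁅x, y⁆ = 0

/-- Ideals `m ≤ n` with `m` a plane, central in `n` and containing the brackets of `n`. -/
structure IsCentralPlane (m n : Submodule ℂ 𝔤) : Prop where
  le : m ≤ n
  lie_mem_right : ∀ x : 𝔤, ∀ y ∈ n, ⁅x, y⁆ ∈ n
  lie_mem_left : ∀ x : 𝔤, ∀ y ∈ m, ⁅x, y⁆ ∈ m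
  lie_mem : ∀ x ∈ n, ∀ y ∈ n, ⁅x, y⁆ ∈ m
  lie_eq_zero : ∀ x ∈ n, ∀ y ∈ m, ⁅x, y⁆ = 0
  finrank_eq : Module.finrank ℂ m = 2

namespace IsILCTriple

variable {𝔢 𝔣 : LieSubalgebra ℂ 𝔤}

/-- The form in which every explicit example except the central-line one is checked: `D` and `φ` are
prescribed on a basis, and antisymmetry leaves ten pairs. -/
theorem hasTwistedDerivation_of_basis (h : IsILCTriple 𝔢 𝔣) {e₁ e₂ f₁ f₂ z : 𝔤}
    (he : ∀ x ∈ 𝔢, ∃ s t : ℂ, x = s • e₁ + t • e₂) (hf : ∀ x ∈ 𝔣, ∃ s t : ℂ, x = s • f₁ + t • f₂)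
    (hz : z ∉ 𝔢.toSubmodule ⊔ 𝔣.toSubmodule) {d₁ d₂ d₃ d₄ : 𝔤} (hd₁ : d₁ ∈ 𝔢) (hd₂ : d₂ ∈ 𝔢)
    (hd₃ : d₃ ∈ 𝔣) (hd₄ : d₄ ∈ 𝔣) (hne : d₁ ≠ 0 ∨ d₂ ≠ 0) (p q : ℂ)
    (H : ∀ (D : 𝔤 →ₗ[ℂ] 𝔤) (φ : 𝔤 →ₗ[ℂ] ℂ), D e₁ = d₁ → D e₂ = d₂ → D f₁ = d₃ → D f₂ = d₄ →
      D z = 0 → φ e₁ = p → φ e₂ = 0 → φ f₁ = q → φ f₂ = 0 → φ z = 0 →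
      (TwistedAt D φ e₁ e₂ ∧ TwistedAt D φ e₁ f₁ ∧ TwistedAt D φ e₁ f₂ ∧ TwistedAt D φ e₁ z) ∧
      (TwistedAt D φ e₂ f₁ ∧ TwistedAt D φ e₂ f₂ ∧ TwistedAt D φ e₂ z) ∧
      (TwistedAt D φ f₁ f₂ ∧ TwistedAt D φ f₁ z) ∧ TwistedAt D φ f₂ z) :
    HasTwistedDerivation 𝔢 𝔣 := by
  obtain ⟨B, hB⟩ := h.exists_basis he hf hz
  set D : 𝔤 →ₗ[ℂ] 𝔤 := B.constr ℂ ![d₁, d₂, d₃, d₄, 0] with hD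
  set φ : 𝔤 →ₗ[ℂ] ℂ := B.constr ℂ ![p, 0, q, 0, 0] with hφ
  have hDB : ∀ i, D (![e₁, e₂, f₁, f₂, z] i) = ![d₁, d₂, d₃, d₄, 0] i := fun i => by
    rw [← hB, hD, B.constr_basis]
  have hφB : ∀ i, φ (![e₁, e₂, f₁, f₂, z] i) = ![p, 0, q, 0, 0] i := fun i => by
    rw [← hB, hφ, B.constr_basis]
  have hD1 : D e₁ = d₁ := hDB 0
  have hD2 : D e₂ = d₂ := hDB 1
  have hD3 : D f₁ = d₃ := hDB 2
  have hD4 : D f₂ = d₄ := hDB 3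
  obtain ⟨⟨h01, h02, h03, h04⟩, ⟨h12, h13, h14⟩, ⟨h23, h24⟩, h34⟩ :=
    H D φ hD1 hD2 hD3 hD4 (hDB 4) (hφB 0) (hφB 1) (hφB 2) (hφB 3) (hφB 4)
  have hall : ∀ i j, i < j → TwistedAt D φ (B i) (B j) := by
    rw [hB]
    intro i j hij
    fin_cases i <;> fin_cases j <;> first | exact absurd hij (by decide) | assumption
  refine ⟨D, φ, .of_basis B (fun i j hij => (hall i j hij).1) fun i j hij => (hall i j hij).2,
    ?_, ?_, ?_⟩
  · intro h0
    rcases hne with h1 | h1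
    · exact h1 (by rw [← hD1, h0]; rfl)
    · exact h1 (by rw [← hD2, h0]; rfl)
  · intro x hx
    obtain ⟨s, t, rfl⟩ := he x hx
    rw [map_add, map_smul, map_smul, hD1, hD2]
    exact add_mem (𝔢.smul_mem _ hd₁) (𝔢.smul_mem _ hd₂)
  · intro x hx
    obtain ⟨s, t, rfl⟩ := hf x hx
    rw [map_add, map_smul, map_smul, hD3, hD4]
    exact add_mem (𝔣.smul_mem _ hd₃) (𝔣.smul_mem _ hd₄)

/-- Brackets of `x` with `𝔢` stay in `𝔢`, so non-degeneracy must be witnessed in `𝔣`; if `f'` does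
not witness it, `f` must. This supplies the fifth basis vector, transverse to `C`. -/
theorem lie_notMem_sup (h : IsILCTriple 𝔢 𝔣) {x f f' : 𝔤} (hx : x ∈ 𝔢) (hx0 : x ≠ 0)
    (hf : ∀ y ∈ 𝔣, ∃ s t : ℂ, y = s • f + t • f') (hf' : ⁅x, f'⁆ ∈ 𝔢.toSubmodule ⊔ 𝔣.toSubmodule) :
    ⁅x, f⁆ ∉ 𝔢.toSubmodule ⊔ 𝔣.toSubmodule := by
  intro hxf
  refine hx0 (h.nondegenerate x (Submodule.mem_sup_left hx) fun y hy => ?_)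
  obtain ⟨u, hu, v, hv, rfl⟩ := Submodule.mem_sup.1 hy
  obtain ⟨s, t, rfl⟩ := hf v hv
  rw [lie_add, lie_add, lie_smul, lie_smul]
  exact add_mem (Submodule.mem_sup_left (𝔢.lie_mem hx hu))
    (add_mem (Submodule.smul_mem _ _ hxf) (Submodule.smul_mem _ _ hf'))

/-- Since `e₁ + f₁` commutes with `n`, `ad f₁ = -ad e₁` there, so both preserve the lines of `e₂`
and of `f₂`. Hence `𝔤` is graded with `e₂` in weight `1`, `f₂` in weight `-1`, and `e₁`, `f₁`, `⁅e₂,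
f₂⁆` in weight `0`; `D` is the grading derivation and `φ = 0`. -/
theorem hasTwistedDerivation_of_notMem (h : IsILCTriple 𝔢 𝔣) {m n : Submodule ℂ 𝔤}
    (hmn : IsCentralPlane m n) {e₁ e₂ f₁ f₂ : 𝔤} (he₁ : e₁ ∈ 𝔢) (he₂ : e₂ ∈ 𝔢)
    (hf₁ : f₁ ∈ 𝔣) (hf₂ : f₂ ∈ 𝔣) (he₁n : e₁ ∉ n) (he₂n : e₂ ∈ n) (he₂0 : e₂ ≠ 0) (hf₁n : f₁ ∉ n)
    (hf₂n : f₂ ∈ n) (hf₂0 : f₂ ≠ 0) (hl : e₁ + f₁ ∈ m) : HasTwistedDerivation 𝔢 𝔣 := by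
  have he := fun x (hx : x ∈ 𝔢) => Submodule.exists_eq_smul_add_smul (S := 𝔢.toSubmodule)
    h.finrank_left he₂ he₂n he₂0 he₁ he₁n hx
  have hf := fun x (hx : x ∈ 𝔣) => Submodule.exists_eq_smul_add_smul (S := 𝔣.toSubmodule)
    h.finrank_right hf₂ hf₂n hf₂0 hf₁ hf₁n hx
  have hl0 : e₁ + f₁ ≠ 0 := by
    intro h0
    apply he₁n
    rw [h.eq_zero_of_mem he₁ (by rw [eq_neg_of_add_eq_zero_left h0]; exact neg_mem hf₁)]
    exact zero_mem _
  obtain ⟨μ, b12⟩ := Submodule.exists_eq_smul_of_mem_inf (S := 𝔢.toSubmodule) h.finrank_left he₂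
    he₂n he₂0 he₁ he₁n (𝔢.lie_mem he₁ he₂) (hmn.lie_mem_right _ _ he₂n)
  obtain ⟨ν, b34⟩ := Submodule.exists_eq_smul_of_mem_inf (S := 𝔣.toSubmodule) h.finrank_right hf₂
    hf₂n hf₂0 hf₁ hf₁n (𝔣.lie_mem hf₁ hf₂) (hmn.lie_mem_right _ _ hf₂n)
  have b23 : ⁅e₂, f₁⁆ = μ • e₂ := by
    have h1 := hmn.lie_eq_zero e₂ he₂n _ hl
    rw [lie_add, ← lie_skew, b12] at h1
    rw [← sub_eq_zero, ← h1]; abel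
  have b14 : ⁅e₁, f₂⁆ = -(ν • f₂) := by
    have h1 := hmn.lie_eq_zero f₂ hf₂n _ hl
    rw [← lie_skew, add_lie, b34] at h1
    rw [← sub_eq_zero, ← neg_eq_zero, ← h1]; abel
  obtain ⟨z, hz⟩ : ∃ z, z = ⁅e₂, f₂⁆ := ⟨_, rfl⟩
  have hzm : z ∈ m := hz ▸ hmn.lie_mem _ he₂n _ hf₂n
  have hzC : z ∉ 𝔢.toSubmodule ⊔ 𝔣.toSubmodule := by
    rw [hz]
    refine h.lie_notMem_sup he₂ he₂0 hf ?_
    rw [b23]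
    exact Submodule.mem_sup_left (𝔢.smul_mem _ he₂)
  have hlC : e₁ + f₁ ∈ 𝔢.toSubmodule ⊔ 𝔣.toSubmodule := Submodule.add_mem_sup he₁ hf₁
  obtain ⟨c₁, c₂, hc⟩ := Submodule.exists_eq_smul_add_smul hmn.finrank_eq hl hlC hl0 hzm hzC (hmn.lie_mem_left e₁ _ hl)
  have b13 : ⁅e₁, f₁⁆ = c₁ • (e₁ + f₁) + c₂ • z := by rw [← hc]; simp
  have b15 : ⁅e₁, z⁆ = (μ - ν) • z := by
    rw [hz, leibniz_lie, b12, b14, smul_lie, lie_neg, lie_smul]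
    module
  have b35 : ⁅f₁, z⁆ = -((μ - ν) • z) := by
    have h1 := hmn.lie_eq_zero _ (hmn.le hl) _ hzm
    rw [add_lie, b15] at h1
    exact eq_neg_of_add_eq_zero_right h1
  have b25 : ⁅e₂, z⁆ = 0 := hmn.lie_eq_zero _ he₂n _ hzm
  have b45 : ⁅f₂, z⁆ = 0 := hmn.lie_eq_zero _ hf₂n _ hzm
  have he' : ∀ x ∈ 𝔢, ∃ s t : ℂ, x = s • e₁ + t • e₂ := fun x hx => by
    obtain ⟨s, t, h⟩ := he x hx
    exact ⟨t, s, by rw [h, add_comm]⟩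
  have hf' : ∀ x ∈ 𝔣, ∃ s t : ℂ, x = s • f₁ + t • f₂ := fun x hx => by
    obtain ⟨s, t, h⟩ := hf x hx
    exact ⟨t, s, by rw [h, add_comm]⟩
  refine h.hasTwistedDerivation_of_basis he' hf' hzC (zero_mem 𝔢) he₂ (zero_mem 𝔣) (neg_mem hf₂)
    (Or.inr he₂0) 0 0 ?_
  intro D φ D1 D2 D3 D4 D5 P1 P2 P3 P4 P5
  simp [TwistedAt, b12, b13, b14, b15, b23, b25, b34, b35, b45, ← hz, D1, D2, D3, D4, D5, P1, P2,
    P3, P4, P5]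

/-- The derivation is nilpotent: `e₃ ↦ e₂`, `f₃ ↦ -f₂`, all else to zero, with `φ = 0`. On the pair
`e₃, f₃` it requires `ν = -μ` and that the coefficient `σ` of `e₃ + f₃` in `⁅e₃, f₃⁆` equal `μ`. The
ideals `a` and `b` are there for the second equality. -/
theorem hasTwistedDerivation_of_mem (h : IsILCTriple 𝔢 𝔣) {a b m n : Submodule ℂ 𝔤}
    (hmn : IsCentralPlane m n) (ha : ∀ x : 𝔤, ∀ y ∈ a, ⁅x, y⁆ ∈ a)
    (hb : ∀ x : 𝔤, ∀ y ∈ b, ⁅x, y⁆ ∈ b) (hab : a ⊓ b = m) (han : a ≤ n) (hbn : b ≤ n)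
    (ham : ¬ a ≤ m) (hbm : ¬ b ≤ m) {e₂ e₃ f₂ f₃ : 𝔤} (he₂ : e₂ ∈ 𝔢) (he₃ : e₃ ∈ 𝔢)
    (hf₂ : f₂ ∈ 𝔣) (hf₃ : f₃ ∈ 𝔣) (he₃n : e₃ ∉ n) (he₂n : e₂ ∈ n) (he₂0 : e₂ ≠ 0) (hf₃n : f₃ ∉ n)
    (hf₂n : f₂ ∈ n) (hf₂0 : f₂ ≠ 0) (hl : e₂ + f₂ ∈ m) (hk : e₃ + f₃ ∈ n) (he₂a : e₂ ∉ a)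
    (he₂b : e₂ ∉ b) : HasTwistedDerivation 𝔢 𝔣 := by
  have he : ∀ x ∈ 𝔢, ∃ s t : ℂ, x = s • e₃ + t • e₂ := fun x hx => by
    obtain ⟨s, t, h⟩ := Submodule.exists_eq_smul_add_smul (S := 𝔢.toSubmodule)
      h.finrank_left he₂ he₂n he₂0 he₃ he₃n hx
    exact ⟨t, s, by rw [h, add_comm]⟩
  have hf : ∀ x ∈ 𝔣, ∃ s t : ℂ, x = s • f₃ + t • f₂ := fun x hx => by
    obtain ⟨s, t, h⟩ := Submodule.exists_eq_smul_add_smul (S := 𝔣.toSubmodule)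
      h.finrank_right hf₂ hf₂n hf₂0 hf₃ hf₃n hx
    exact ⟨t, s, by rw [h, add_comm]⟩
  have hl0 : e₂ + f₂ ≠ 0 := by
    intro h0
    exact he₂0 (h.eq_zero_of_mem he₂ (by rw [eq_neg_of_add_eq_zero_left h0]; exact neg_mem hf₂))
  obtain ⟨μ, b12⟩ := Submodule.exists_eq_smul_of_mem_inf (S := 𝔢.toSubmodule) h.finrank_left he₂
    he₂n he₂0 he₃ he₃n (𝔢.lie_mem he₃ he₂) (hmn.lie_mem_right _ _ he₂n)
  obtain ⟨ν, b34⟩ := Submodule.exists_eq_smul_of_mem_inf (S := 𝔣.toSubmodule) h.finrank_right hf₂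
    hf₂n hf₂0 hf₃ hf₃n (𝔣.lie_mem hf₃ hf₂) (hmn.lie_mem_right _ _ hf₂n)
  have b24 : ⁅e₂, f₂⁆ = 0 := by
    have h1 := hmn.lie_eq_zero e₂ he₂n _ hl
    simpa using h1
  obtain ⟨z, hz⟩ : ∃ z, z = ⁅e₂, e₃ + f₃⁆ := ⟨_, rfl⟩
  have hzm : z ∈ m := hz ▸ hmn.lie_mem _ he₂n _ hk
  have b23 : ⁅e₂, f₃⁆ = z + μ • e₂ := by
    rw [hz, lie_add, ← lie_skew e₂ e₃, b12]; abel
  have hzC : z ∉ 𝔢.toSubmodule ⊔ 𝔣.toSubmodule := by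
    intro hzC
    refine h.lie_notMem_sup he₂ he₂0 hf (by rw [b24]; exact zero_mem _) ?_
    rw [b23]
    exact add_mem hzC (Submodule.mem_sup_left (𝔢.smul_mem _ he₂))
  have hz0 : z ≠ 0 := fun h0 => hzC (h0 ▸ zero_mem _)
  have b14 : ⁅e₃, f₂⁆ = z - ν • f₂ := by
    have h1 := hmn.lie_eq_zero _ hk _ hl
    rw [lie_add, ← lie_skew, ← hz, add_lie, b34] at h1
    rw [← sub_eq_zero, ← h1]; abel
  have hlC : e₂ + f₂ ∈ 𝔢.toSubmodule ⊔ 𝔣.toSubmodule := Submodule.add_mem_sup he₂ hf₂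
  have hmspan := fun w (hw : w ∈ m) =>
    Submodule.exists_eq_smul_add_smul hmn.finrank_eq hl hlC hl0 hzm hzC hw
  -- Up to `z`, `⁅e₃, e₂ + f₂⁆` is `μ • e₂ - ν • f₂`, which lies in `m ∩ C` and is therefore a
  -- multiple of `e₂ + f₂`.
  have hνμ : ν = -μ := by
    have h1 : μ • e₂ - ν • f₂ ∈ m := by
      have h2 := sub_mem (hmn.lie_mem_left e₃ _ hl) hzm
      rw [lie_add, b12, b14] at h2
      convert h2 using 1; abel
    obtain ⟨s, hs⟩ := Submodule.exists_eq_smul_of_mem_inf hmn.finrank_eq hl hlC hl0 hzm hzC h1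
      (sub_mem (Submodule.mem_sup_left (𝔢.smul_mem _ he₂))
        (Submodule.mem_sup_right (𝔣.smul_mem _ hf₂)))
    have h3 : (μ - s) • e₂ = (ν + s) • f₂ := by
      rw [← sub_eq_zero]
      rw [← sub_eq_zero] at hs
      rw [← hs]; module
    have h4 : (μ - s) • e₂ = 0 :=
      h.eq_zero_of_mem (𝔢.smul_mem _ he₂) (h3 ▸ 𝔣.smul_mem _ hf₂)
    have h5 := (smul_eq_zero.1 h4).resolve_right he₂0
    rw [h4] at h3
    have h6 := (smul_eq_zero.1 h3.symm).resolve_right hf₂0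
    linear_combination h5 + h6
  have hspan : ∀ w ∈ n, ∃ t r : ℂ, ∃ w' ∈ m, w = t • (e₃ + f₃) + r • e₂ + w' := by
    intro w hw
    obtain ⟨B, hB⟩ := h.exists_basis he hf hzC
    have h1 := B.sum_repr w
    rw [hB] at h1
    simp only [Fin.sum_univ_five] at h1
    set c := B.repr w
    have h2 : w = c 0 • e₃ + c 1 • e₂ + c 2 • f₃ + c 3 • f₂ + c 4 • z := h1.symm
    have h3 : (c 0 - c 2) • e₃ ∈ n := by
      have h4 : (c 0 - c 2) • e₃
          = w - (c 2 • (e₃ + f₃) + c 1 • e₂ + c 3 • f₂ + c 4 • z) := by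
        rw [h2]; module
      rw [h4]
      exact sub_mem hw (add_mem (add_mem (add_mem (n.smul_mem _ hk) (n.smul_mem _ he₂n))
        (n.smul_mem _ hf₂n)) (n.smul_mem _ (hmn.le hzm)))
    have h5 : c 0 = c 2 := by
      by_contra hne
      exact he₃n ((n.smul_mem_iff (sub_ne_zero.2 hne)).1 h3)
    refine ⟨c 0, c 1 - c 3, c 3 • (e₂ + f₂) + c 4 • z,
      add_mem (m.smul_mem _ hl) (m.smul_mem _ hzm), ?_⟩
    rw [h2, ← h5]; module
  have key : ∀ S : Submodule ℂ 𝔤, S ≤ n → ¬ S ≤ m → m ≤ S → e₂ ∉ S →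
      ∃ r : ℂ, (e₃ + f₃) + r • e₂ ∈ S := by
    intro S hSn hSm hmS heS
    obtain ⟨w, hwS, hwm⟩ := Set.not_subset.1 hSm
    obtain ⟨t, r, w', hw', rfl⟩ := hspan w (hSn hwS)
    have h1 : t • (e₃ + f₃) + r • e₂ ∈ S := (S.add_mem_iff_left (hmS hw')).1 hwS
    by_cases ht : t = 0
    · subst ht
      rw [zero_smul, zero_add] at h1
      by_cases hr : r = 0
      · subst hr
        exact absurd (by simpa using hw') hwm
      · exact absurd ((S.smul_mem_iff hr).1 h1) heS
    · refine ⟨t⁻¹ * r, ?_⟩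
      have h2 := S.smul_mem t⁻¹ h1
      rwa [smul_add, smul_smul, smul_smul, inv_mul_cancel₀ ht, one_smul] at h2
  have hma : m ≤ a := hab ▸ inf_le_left
  have hmb : m ≤ b := hab ▸ inf_le_right
  obtain ⟨r, hr⟩ := key a han ham hma he₂a
  obtain ⟨r', hr'⟩ := key b hbn hbm hmb he₂b
  have hrr : r ≠ r' := by
    rintro rfl
    have h1 : (e₃ + f₃) + r • e₂ ∈ m := hab ▸ ⟨hr, hr'⟩
    have h2 := hmn.lie_eq_zero _ he₂n _ h1
    rw [lie_add, ← hz, lie_smul, lie_self, smul_zero, add_zero] at h2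
    exact hz0 h2
  obtain ⟨σ, ρ, w, hw, hσ⟩ := hspan _ (hmn.lie_mem_right e₃ _ hk)
  -- Modulo `m`, the map `ad e₃` on the plane `n / m` has the eigenline of `e₂`, with eigenvalue
  -- `μ`, and the distinct eigenlines of `a` and `b`. Three eigenlines in a plane make it scalar, so
  -- `σ = μ`.
  have key' : ∀ S : Submodule ℂ 𝔤, (∀ x : 𝔤, ∀ y ∈ S, ⁅x, y⁆ ∈ S) → m ≤ S → e₂ ∉ S → ∀ r : ℂ,
      (e₃ + f₃) + r • e₂ ∈ S → ρ + r * (μ - σ) = 0 := by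
    intro S hS hmS heS r hr
    have h1 := sub_mem (sub_mem (hS e₃ _ hr) (S.smul_mem σ hr)) (hmS hw)
    rw [lie_add, hσ, lie_smul, b12] at h1
    have h2 : (ρ + r * (μ - σ)) • e₂ ∈ S := by
      convert h1 using 1; module
    by_contra hne
    exact heS ((S.smul_mem_iff hne).1 h2)
  have hσμ : σ = μ := by
    have h1 := key' a ha hma he₂a r hr
    have h2 := key' b hb hmb he₂b r' hr'
    have h3 : (r - r') * (μ - σ) = 0 := by linear_combination h1 - h2
    exact (sub_eq_zero.1 ((mul_eq_zero.1 h3).resolve_left (sub_ne_zero.2 hrr))).symm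
  obtain ⟨m₁, m₂, rfl⟩ := hmspan w hw
  have b13 : ⁅e₃, f₃⁆ = μ • (e₃ + f₃) + ρ • e₂ + (m₁ • (e₂ + f₂) + m₂ • z) := by
    rw [← hσμ, ← hσ]; simp
  obtain ⟨q₁, q₂, b15⟩ := hmspan _ (hmn.lie_mem_left e₃ z hzm)
  obtain ⟨q₃, q₄, b35⟩ := hmspan _ (hmn.lie_mem_left f₃ z hzm)
  have b25 : ⁅e₂, z⁆ = 0 := hmn.lie_eq_zero _ he₂n _ hzm
  have b45 : ⁅f₂, z⁆ = 0 := hmn.lie_eq_zero _ hf₂n _ hzm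
  refine h.hasTwistedDerivation_of_basis he hf hzC he₂ (zero_mem 𝔢) (neg_mem hf₂) (zero_mem 𝔣)
    (Or.inl he₂0) 0 0 ?_
  intro D φ D1 D2 D3 D4 D5 P1 P2 P3 P4 P5
  subst hνμ
  simp [TwistedAt, b12, b13, b14, b15, b23, b24, b25, b34, b35, b45, D1, D2, D3, D4, D5, P1,
    P2, P3, P4, P5]
  module

/-- Take `D` with `e ↦ x`, `f ↦ y`, zero on `a`. The identity on the pair `e, f` forces `φ e = -v -
c₂` and `φ f = u + c₁`, and then `φ ⁅e, f⁆ = v * c₁ - u * c₂`, so `huv` is the character condition.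
-/
theorem hasTwistedDerivation_of_lie_eq (h : IsILCTriple 𝔢 𝔣) {a : Submodule ℂ 𝔤}
    (haa : ∀ x ∈ a, ∀ y ∈ a, ⁅x, y⁆ = 0) {x e y f z : 𝔤}
    (hx : x ∈ 𝔢) (hy : y ∈ 𝔣) (hxa : x ∈ a) (hya : y ∈ a) (hza : z ∈ a) (hx0 : x ≠ 0)
    (he : ∀ w ∈ 𝔢, ∃ s t : ℂ, w = s • e + t • x) (hf : ∀ w ∈ 𝔣, ∃ s t : ℂ, w = s • f + t • y)
    (hz : z ∉ 𝔢.toSubmodule ⊔ 𝔣.toSubmodule)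
    (ha : ∀ w ∈ a, ∃ p q r : ℂ, w = p • x + q • y + r • z) (hea : ⁅e, z⁆ ∈ a) (hfa : ⁅f, z⁆ ∈ a)
    {α β c₁ c₂ u v : ℂ} {w₀ : 𝔤} (hw₀ : w₀ ∈ a) (hex : ⁅e, x⁆ = α • x) (hey : ⁅e, y⁆ = z)
    (hfy : ⁅f, y⁆ = β • y) (hfx : ⁅f, x⁆ = z + c₁ • x + c₂ • y)
    (hef : ⁅e, f⁆ = u • e + v • f + w₀) (huv : v * c₁ = u * c₂) : HasTwistedDerivation 𝔢 𝔣 := by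
  obtain ⟨p₁, p₂, p₃, rfl⟩ := ha w₀ hw₀
  obtain ⟨q₁, q₂, q₃, hez⟩ := ha _ hea
  obtain ⟨r₁, r₂, r₃, hfz⟩ := ha _ hfa
  have hxf : ⁅x, f⁆ = -(z + c₁ • x + c₂ • y) := by rw [← lie_skew, hfx]
  have hxy := haa x hxa y hya
  have hxz := haa x hxa z hza
  have hyz := haa y hya z hza
  refine h.hasTwistedDerivation_of_basis he hf hz hx (zero_mem 𝔢) hy (zero_mem 𝔣)
    (Or.inl hx0) (- v - c₂) (u + c₁) ?_
  intro D φ D1 D2 D3 D4 D5 P1 P2 P3 P4 P5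
  refine ⟨⟨?_, ?_, ?_, ?_⟩, ⟨?_, ?_, ?_⟩, ⟨?_, ?_⟩, ?_⟩ <;>
    simp [TwistedAt, hex, hey, hfy, hef, hez, hfz, hxf, hxy, hxz, hyz, D1, D2, D3, D4,
      D5, P1, P2, P3, P4, P5]
  exact ⟨by module, by linear_combination huv⟩

end IsILCTriple

end Cases

/-! ### The ideal is not invariant under the anti-involution. -/

section AntiInvolution

variable {𝔤 : Type*} [LieRing 𝔤] [LieAlgebra ℂ 𝔤] {𝔢 𝔣 : LieSubalgebra ℂ 𝔤}
  {τ : 𝔤 →ₛₗ[starRingEnd ℂ] 𝔤}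

namespace IsAdmissibleAntiInvolution

theorem apply_mem_right (hτ : IsAdmissibleAntiInvolution 𝔢 𝔣 τ) {x : 𝔤} (hx : x ∈ 𝔢) :
    τ x ∈ 𝔣 := by
  have h1 : τ x ∈ 𝔢.toSubmodule.map τ := Submodule.mem_map_of_mem hx
  rwa [hτ.map_left] at h1

theorem apply_mem_left (hτ : IsAdmissibleAntiInvolution 𝔢 𝔣 τ) {x : 𝔤} (hx : x ∈ 𝔣) :
    τ x ∈ 𝔢 := by
  have h1 : τ x ∈ 𝔣.toSubmodule.map τ := Submodule.mem_map_of_mem hx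
  rwa [hτ.map_right] at h1

theorem apply_mem_sup (hτ : IsAdmissibleAntiInvolution 𝔢 𝔣 τ) {x : 𝔤}
    (hx : x ∈ 𝔢.toSubmodule ⊔ 𝔣.toSubmodule) : τ x ∈ 𝔢.toSubmodule ⊔ 𝔣.toSubmodule := by
  obtain ⟨u, hu, v, hv, rfl⟩ := Submodule.mem_sup.1 hx
  rw [map_add, add_comm]
  exact Submodule.add_mem_sup (hτ.apply_mem_left hv) (hτ.apply_mem_right hu)

theorem mem_map_iff (hτ : IsAdmissibleAntiInvolution 𝔢 𝔣 τ) {S : Submodule ℂ 𝔤} {x : 𝔤} :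
    x ∈ S.map τ ↔ τ x ∈ S := by
  refine ⟨?_, fun hx => ⟨τ x, hx, hτ.involutive x⟩⟩
  rintro ⟨y, hy, rfl⟩
  rwa [hτ.involutive y]

end IsAdmissibleAntiInvolution

namespace IsILCTriple

/-- If the bracket takes values in a central line, the triple is flat, with grading derivation. -/
theorem hasTwistedDerivation_of_central (h : IsILCTriple 𝔢 𝔣) {z : 𝔤} (hz0 : z ≠ 0)
    (hz : ∀ x : 𝔤, ⁅x, z⁆ = 0) (hspan : ∀ x y : 𝔤, ∃ s : ℂ, ⁅x, y⁆ = s • z) :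
    HasTwistedDerivation 𝔢 𝔣 := by
  have hzC : z ∉ 𝔢.toSubmodule ⊔ 𝔣.toSubmodule := fun hzC =>
    hz0 (h.nondegenerate z hzC fun y _ => by
      rw [← lie_skew, hz, neg_zero]; exact zero_mem _)
  obtain ⟨η, hη, hC⟩ := Submodule.exists_le_ker_of_notMem hzC
  set ζ : 𝔤 →ₗ[ℂ] ℂ := (η z)⁻¹ • η with hζ
  have hζz : ζ z = 1 := by simp [hζ, hη]
  have hζC : ∀ x ∈ 𝔢.toSubmodule ⊔ 𝔣.toSubmodule, ζ x = 0 := fun x hx => by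
    have : η x = 0 := hC hx
    simp [hζ, this]
  have hzl : ∀ x : 𝔤, ⁅z, x⁆ = 0 := fun x => by rw [← lie_skew, hz, neg_zero]
  -- Weight `1` on `C` and weight `2` on `z`.
  refine ⟨LinearMap.id + ζ.smulRight z, 0, ⟨fun x y => ?_, fun x y => rfl⟩, fun h0 => ?_,
    fun x hx => ?_, fun x hx => ?_⟩
  · obtain ⟨s, hs⟩ := hspan x y
    simp [hs, hz, hzl, hζz]
  · have h1 := LinearMap.congr_fun h0 z
    simp only [LinearMap.add_apply, LinearMap.id_apply, LinearMap.smulRight_apply, hζz, one_smul,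
      LinearMap.zero_apply] at h1
    rw [← two_smul ℂ] at h1
    exact hz0 ((smul_eq_zero.1 h1).resolve_left two_ne_zero)
  · simpa [hζC x (Submodule.mem_sup_left hx)] using hx
  · simpa [hζC x (Submodule.mem_sup_right hx)] using hx

/-- By non-degeneracy the ideal `m` is not inside `C`, so the plane `m` meets `C` in a line, spanned
by some `e + f`. Whether `e` lies in `n` selects between `hasTwistedDerivation_of_mem` and
`hasTwistedDerivation_of_notMem`. -/
theorem hasTwistedDerivation_of_isCentralPlane (h : IsILCTriple 𝔢 𝔣)
    (hτ : IsAdmissibleAntiInvolution 𝔢 𝔣 τ) {a m n : Submodule ℂ 𝔤} (hmn : IsCentralPlane m n)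
    (hn : Module.finrank ℂ n = 4) (ha : ∀ x : 𝔤, ∀ y ∈ a, ⁅x, y⁆ ∈ a)
    (hb : ∀ x : 𝔤, ∀ y ∈ a.map τ, ⁅x, y⁆ ∈ a.map τ) (hm : a ⊓ a.map τ = m)
    (hsup : a ⊔ a.map τ = n) (ham : ¬ a ≤ m) (hbm : ¬ a.map τ ≤ m) :
    HasTwistedDerivation 𝔢 𝔣 := by
  have := h.finiteDimensional
  have hτm : ∀ x ∈ m, τ x ∈ m := by
    rintro x hx
    rw [← hm] at hx ⊢
    exact ⟨hτ.mem_map_iff.1 hx.2, Submodule.mem_map_of_mem hx.1⟩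
  have hτn : ∀ x ∈ n, τ x ∈ n := by
    intro x hx
    rw [← hsup] at hx ⊢
    obtain ⟨u, hu, v, hv, rfl⟩ := Submodule.mem_sup.1 hx
    rw [map_add, add_comm]
    exact Submodule.add_mem_sup (hτ.mem_map_iff.1 hv) (Submodule.mem_map_of_mem hu)
  have hτn' : ∀ x, x ∉ n → τ x ∉ n := fun x hx hx' => hx (by simpa [hτ.involutive x] using hτn _ hx')
  have hτ0 : ∀ x, x ≠ 0 → τ x ≠ 0 := fun x hx hx' => hx (by rw [← hτ.involutive x, hx', map_zero])
  have hmC : ¬ m ≤ 𝔢.toSubmodule ⊔ 𝔣.toSubmodule := by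
    intro hle
    have hbot : m = ⊥ := (Submodule.eq_bot_iff _).2 fun x hx => h.nondegenerate x (hle hx)
      fun y _ => hle (by rw [← lie_skew]; exact neg_mem (hmn.lie_mem_left y x hx))
    have h1 := hmn.finrank_eq
    rw [hbot, finrank_bot] at h1
    omega
  have hCn : ¬ 𝔢.toSubmodule ⊔ 𝔣.toSubmodule ≤ n := by
    intro hle
    have heq := Submodule.eq_of_le_of_finrank_eq hle (by rw [h.finrank_sup, hn])
    exact hmC (heq ▸ hmn.le)
  obtain ⟨T, hT, hTn⟩ : ∃ T ∈ 𝔢, T ∉ n := by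
    by_contra! hall
    refine hCn (sup_le hall fun x hx => ?_)
    have h1 := hτn _ (hall _ (hτ.apply_mem_left hx))
    rwa [hτ.involutive x] at h1
  have hτT := hτ.apply_mem_right hT
  have hτTn := hτn' T hTn
  obtain ⟨ℓ, hℓm, hℓC, hℓ0⟩ := Submodule.exists_mem_inf_ne_zero (S := m)
    (N := 𝔢.toSubmodule ⊔ 𝔣.toSubmodule) (by
      rw [h.finrank_eq, hmn.finrank_eq, h.finrank_sup]; omega)
  obtain ⟨w, hwm, hwC⟩ := Set.not_subset.1 hmC
  have hℓspan : ∀ x ∈ m, x ∈ 𝔢.toSubmodule ⊔ 𝔣.toSubmodule → ∃ s : ℂ, x = s • ℓ := fun x hx hx' =>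
    Submodule.exists_eq_smul_of_mem_inf hmn.finrank_eq hℓm hℓC hℓ0 hwm hwC hx hx'
  obtain ⟨e, he, f, hf, rfl⟩ := Submodule.mem_sup.1 hℓC
  have hfn : f ∈ n ↔ e ∈ n := by
    constructor <;> intro h1
    · exact (n.add_mem_iff_left h1).1 (hmn.le hℓm)
    · exact (n.add_mem_iff_right h1).1 (hmn.le hℓm)
  by_cases hen : e ∈ n
  -- The line `m ∩ C` is `τ`-stable, so `τ e = s • f` and `τ f = s • e`. If `e` were in `a` or in `τ
  -- a`, then `f` would lie in both, hence in `m`, against `m ∩ C` being the line of `e + f`.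
  · obtain ⟨s, hs⟩ := hℓspan _ (hτm _ hℓm) (hτ.apply_mem_sup hℓC)
    rw [map_add, smul_add] at hs
    have hs' : τ e - s • f = s • e - τ f := by
      rw [sub_eq_sub_iff_add_eq_add, hs]
    have hse : τ e = s • f := sub_eq_zero.1 (h.eq_zero_of_mem
      (hs' ▸ sub_mem (𝔢.smul_mem _ he) (hτ.apply_mem_left hf))
      (sub_mem (hτ.apply_mem_right he) (𝔣.smul_mem _ hf)))
    have hsf : τ f = s • e := by
      rw [hse, sub_self] at hs'
      exact (sub_eq_zero.1 hs'.symm).symm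
    have he0 : e ≠ 0 := by
      rintro rfl
      rw [smul_zero] at hsf
      refine hℓ0 ?_
      rw [zero_add]
      by_contra hf0
      exact hτ0 f hf0 hsf
    have hs0 : s ≠ 0 := by
      rintro rfl
      exact hτ0 e he0 (by rw [hse, zero_smul])
    have hf0 : f ≠ 0 := by
      rintro rfl
      exact hτ0 e he0 (by rw [hse, smul_zero])
    have hfm : f ∉ m := by
      intro hfm
      obtain ⟨t, ht⟩ := hℓspan f hfm (Submodule.mem_sup_right hf)
      have h1 : t • e = (1 - t) • f := by
        have h2 : f - t • (e + f) = 0 := sub_eq_zero.2 ht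
        rw [← sub_eq_zero, ← neg_eq_zero, ← h2]; module
      have h3 := h.eq_zero_of_mem (𝔢.smul_mem t he) (h1 ▸ 𝔣.smul_mem _ hf)
      have ht0 := (smul_eq_zero.1 h3).resolve_right he0
      rw [ht0, zero_smul] at ht
      exact hf0 ht
    have hτf : ∀ S : Submodule ℂ 𝔤, τ e ∈ S → f ∈ S := fun S hS =>
      (S.smul_mem_iff hs0).1 (hse ▸ hS)
    have hea : e ∉ a := by
      intro hea
      refine hfm ?_
      rw [← hm]
      refine ⟨(a.add_mem_iff_right hea).1 ?_, hτf _ (Submodule.mem_map_of_mem hea)⟩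
      rw [← hm] at hℓm
      exact hℓm.1
    have heb : e ∉ a.map τ := by
      intro heb
      refine hfm ?_
      rw [← hm]
      refine ⟨hτf _ (hτ.mem_map_iff.1 heb), ((a.map τ).add_mem_iff_right heb).1 ?_⟩
      rw [← hm] at hℓm
      exact hℓm.2
    have htop : n ⊔ Submodule.span ℂ {T} = ⊤ := by
      have hlt : n < n ⊔ Submodule.span ℂ {T} := lt_of_le_of_ne le_sup_left fun heq =>
        hTn (heq ▸ Submodule.mem_sup_right (Submodule.mem_span_singleton_self T))
      have h1 := Submodule.finrank_lt_finrank_of_lt hlt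
      have h2 := Submodule.finrank_le (n ⊔ Submodule.span ℂ {T})
      have h3 := h.finrank_eq
      exact Submodule.eq_top_of_finrank_eq (by omega)
    -- Since `n` is a hyperplane, `τ T` is `r • T` modulo `n`; rescaling by `-r⁻¹` gives a vector of
    -- `𝔣` whose sum with `T` lies in `n`.
    obtain ⟨p, hp, q, hq, hpq⟩ := Submodule.mem_sup.1 (htop ▸ Submodule.mem_top : τ T ∈ n ⊔ _)
    obtain ⟨r, rfl⟩ := Submodule.mem_span_singleton.1 hq
    have hr0 : r ≠ 0 := by
      rintro rfl
      rw [zero_smul, add_zero] at hpq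
      exact hτTn (hpq ▸ hp)
    have hr0' : -r⁻¹ ≠ 0 := neg_ne_zero.2 (inv_ne_zero hr0)
    refine h.hasTwistedDerivation_of_mem hmn ha hb hm (hsup ▸ le_sup_left) (hsup ▸ le_sup_right) ham
      hbm he hT hf (𝔣.smul_mem (-r⁻¹) hτT) hTn hen he0 (fun h1 => hτTn ((n.smul_mem_iff hr0').1 h1))
      (hfn.2 hen) hf0 hℓm ?_ hea heb
    have h4 : T + -r⁻¹ • τ T = -r⁻¹ • p := by
      rw [← hpq, smul_add, smul_smul, neg_mul, inv_mul_cancel₀ hr0]; module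
    rw [h4]
    exact n.smul_mem _ hp
  · obtain ⟨e₂, he₂, he₂n, he₂0⟩ := Submodule.exists_mem_inf_ne_zero (S := 𝔢.toSubmodule) (N := n) (by
      have h1 : Module.finrank ℂ 𝔢.toSubmodule = 2 := h.finrank_left
      rw [h.finrank_eq, h1, hn]; omega)
    exact h.hasTwistedDerivation_of_notMem hmn he he₂ hf (hτ.apply_mem_right he₂) hen he₂n he₂0
      (fun h1 => hen (hfn.1 h1)) (hτn _ he₂n) (hτ0 _ he₂0) hℓm

/-- Both `a` and `τ a` are abelian ideals, so within `a + τ a` only mixed brackets survive. They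
land in `a ∩ τ a`, which commutes with `a + τ a`. Its dimension is one (then `a + τ a = 𝔤`) or two.
-/
theorem hasTwistedDerivation_of_map_ne (h : IsILCTriple 𝔢 𝔣)
    (hτ : IsAdmissibleAntiInvolution 𝔢 𝔣 τ) {a : Submodule ℂ 𝔤}
    (ha : ∀ x : 𝔤, ∀ y ∈ a, ⁅x, y⁆ ∈ a) (haa : ∀ x ∈ a, ∀ y ∈ a, ⁅x, y⁆ = 0)
    (hdim : Module.finrank ℂ a = 3) (hne : a.map τ ≠ a) : HasTwistedDerivation 𝔢 𝔣 := by
  have := h.finiteDimensional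
  have hdimb := Submodule.finrank_map_conj hτ.involutive a
  have hb : ∀ x : 𝔤, ∀ y ∈ a.map τ, ⁅x, y⁆ ∈ a.map τ := by
    intro x y hy
    rw [hτ.mem_map_iff] at hy ⊢
    rw [hτ.map_lie]
    exact ha _ _ hy
  have hbb : ∀ x ∈ a.map τ, ∀ y ∈ a.map τ, ⁅x, y⁆ = 0 := by
    rintro _ ⟨x, hx, rfl⟩ _ ⟨y, hy, rfl⟩
    rw [← hτ.map_lie, haa x hx y hy, map_zero]
  have ha' : ∀ y ∈ a, ∀ x : 𝔤, ⁅y, x⁆ ∈ a := fun y hy x => by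
    rw [← lie_skew]; exact neg_mem (ha x y hy)
  have hb' : ∀ y ∈ a.map τ, ∀ x : 𝔤, ⁅y, x⁆ ∈ a.map τ := fun y hy x => by
    rw [← lie_skew]; exact neg_mem (hb x y hy)
  have hdims := Submodule.finrank_sup_add_finrank_inf_eq a (a.map τ)
  have hle := Submodule.finrank_le (a ⊔ a.map τ)
  rw [h.finrank_eq] at hle
  have ham : ¬ a ≤ a ⊓ a.map τ := fun hle =>
    hne (Submodule.eq_of_le_of_finrank_eq (hle.trans inf_le_right) hdimb.symm).symm
  have hbm : ¬ a.map τ ≤ a ⊓ a.map τ := fun hle =>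
    hne (Submodule.eq_of_le_of_finrank_eq (hle.trans inf_le_left) hdimb)
  have hlt := Submodule.finrank_lt_finrank_of_lt (lt_of_le_of_ne inf_le_left fun heq => ham heq.ge)
  have hlie : ∀ x ∈ a ⊔ a.map τ, ∀ y ∈ a ⊔ a.map τ, ⁅x, y⁆ ∈ a ⊓ a.map τ := by
    intro x hx y hy
    obtain ⟨u, hu, v, hv, rfl⟩ := Submodule.mem_sup.1 hx
    obtain ⟨u', hu', v', hv', rfl⟩ := Submodule.mem_sup.1 hy
    rw [add_lie, lie_add, lie_add, haa u hu u' hu', hbb v hv v' hv', zero_add, add_zero]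
    exact add_mem ⟨ha' _ hu _, hb _ _ hv'⟩ ⟨ha _ _ hu', hb' _ hv _⟩
  have hzero : ∀ x ∈ a ⊔ a.map τ, ∀ y ∈ a ⊓ a.map τ, ⁅x, y⁆ = 0 := by
    intro x hx y hy
    obtain ⟨u, hu, v, hv, rfl⟩ := Submodule.mem_sup.1 hx
    rw [add_lie, haa u hu y hy.1, hbb v hv y hy.2, add_zero]
  rcases (by omega : Module.finrank ℂ ↥(a ⊓ a.map τ) = 1 ∨ Module.finrank ℂ ↥(a ⊓ a.map τ) = 2)
    with h1 | h2
  · have htop : a ⊔ a.map τ = ⊤ := Submodule.eq_top_of_finrank_eq (by rw [h.finrank_eq]; omega)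
    rw [htop] at hlie hzero
    obtain ⟨z, hz0, hz⟩ := finrank_eq_one_iff'.1 h1
    refine h.hasTwistedDerivation_of_central (z := z) (fun h0 => hz0 (Subtype.ext h0))
      (fun x => hzero x Submodule.mem_top z z.2) fun x y => ?_
    obtain ⟨s, hs⟩ := hz ⟨_, hlie x Submodule.mem_top y Submodule.mem_top⟩
    exact ⟨s, (congrArg Subtype.val hs).symm⟩
  · refine h.hasTwistedDerivation_of_isCentralPlane hτ (a := a) (m := a ⊓ a.map τ) (n := a ⊔ a.map τ)
      ⟨inf_le_left.trans le_sup_left, fun x y hy => ?_, fun x y hy => ⟨ha x y hy.1, hb x y hy.2⟩,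
        hlie, hzero, h2⟩ (by omega) ha hb rfl rfl ham hbm
    obtain ⟨u, hu, v, hv, rfl⟩ := Submodule.mem_sup.1 hy
    rw [lie_add]
    exact Submodule.add_mem_sup (ha x u hu) (hb x v hv)

end IsILCTriple

end AntiInvolution

/-! ### The ideal is invariant and meets the subalgebras. -/

section InvariantIdeal

variable {𝔤 : Type*} [LieRing 𝔤] [LieAlgebra ℂ 𝔤] {𝔢 𝔣 : LieSubalgebra ℂ 𝔤}
  {τ : 𝔤 →ₛₗ[starRingEnd ℂ] 𝔤}

/-- The Jacobi identity for `e`, `f` and an abelian ideal `⟨x, y, z⟩` that both normalize forces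
the structure constant `c` to be real. -/
theorem conj_eq_of_lie_eq {x y z e f w : 𝔤} {α c : ℂ} (hli : LinearIndependent ℂ ![x, y, z])
    (hwx : ⁅w, x⁆ = 0) (hwy : ⁅w, y⁆ = 0) (hwz : ⁅w, z⁆ = 0) (hex : ⁅e, x⁆ = α • x)
    (hey : ⁅e, y⁆ = z) (hfy : ⁅f, y⁆ = starRingEnd ℂ α • y)
    (hfx : ⁅f, x⁆ = z + c • x + (-starRingEnd ℂ c) • y) (hef : ⁅e, f⁆ = -e + f + w) :
    starRingEnd ℂ c = c := by
  set β := starRingEnd ℂ α with hβ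
  set d := starRingEnd ℂ c with hd
  -- The Jacobi identity on `x` and on `y` determines `⁅e, z⁆` and `⁅f, z⁆`; on `z` it then becomes
  -- a constraint on `α` and `c`.
  have hez : ⁅e, z⁆ = (c - α) • x + (-(1 + α) * d) • y + (1 + α + d) • z := by
    have h1 := leibniz_lie e f x
    rw [hef, hfx, hex, add_lie, add_lie, neg_lie, hwx, lie_smul, hex, hfx, lie_add, lie_add,
      lie_smul, lie_smul, hex, hey, ← sub_eq_zero] at h1
    rw [← sub_eq_zero, ← h1]; module
  have hfz : ⁅f, z⁆ = (β + 1) • z - β • y := by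
    have h1 := leibniz_lie e f y
    rw [hef, hfy, hey, add_lie, add_lie, neg_lie, hwy, lie_smul, hey, hfy, ← sub_eq_zero] at h1
    rw [← sub_eq_zero, ← neg_eq_zero, ← h1]; module
  have hjac := leibniz_lie e f z
  rw [hef, add_lie, add_lie, neg_lie, hwz, hfz, lie_sub, lie_smul, lie_smul, hey, hez, lie_add,
    lie_add, lie_smul, lie_smul, lie_smul, hfx, hfy, hfz, ← sub_eq_zero] at hjac
  have hcomb : ((c - α) * (β + 2 - c)) • x
      + ((β + 2) * (-(1 + α) * d) + (c - α) * d + (1 + α) * d * β + (2 + α + d) * β) • y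
      + (2 * α - 2 * β - c + d) • z = 0 := by
    rw [← hjac]; module
  have hcoef := Fintype.linearIndependent_iff.1 hli
    ![(c - α) * (β + 2 - c),
      (β + 2) * (-(1 + α) * d) + (c - α) * d + (1 + α) * d * β + (2 + α + d) * β,
      2 * α - 2 * β - c + d] (by simpa [Fin.sum_univ_three] using hcomb)
  have h0 : (c - α) * (β + 2 - c) = 0 := hcoef 0
  have h2 : 2 * α - 2 * β - c + d = 0 := hcoef 2
  -- The `z`-coefficient gives `Im c = 2 Im α`. The `x`-coefficient gives `c = α` or `c = conj α +
  -- 2`, so `Im c = ± Im α`. Either way `Im c = 0`.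
  have him := congrArg Complex.im h2
  simp [hβ, hd] at him
  rw [hd, Complex.conj_eq_iff_im]
  rcases mul_eq_zero.1 h0 with h3 | h3
  · have h4 := congrArg Complex.im h3
    simp at h4
    linarith
  · have h4 := congrArg Complex.im h3
    simp [hβ] at h4
    linarith

namespace IsILCTriple

/-- The data of a `τ`-invariant abelian ideal `a` and vectors `x ∈ 𝔢 ∩ a`, `e ∈ 𝔢 \ a` give an
adapted basis of `𝔤`. -/
theorem exists_adapted_basis (h : IsILCTriple 𝔢 𝔣)
    (hτ : IsAdmissibleAntiInvolution 𝔢 𝔣 τ) {a : Submodule ℂ 𝔤}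
    (ha : ∀ x : 𝔤, ∀ y ∈ a, ⁅x, y⁆ ∈ a) (haa : ∀ x ∈ a, ∀ y ∈ a, ⁅x, y⁆ = 0)
    (hdim : Module.finrank ℂ a = 3) (hτa : ∀ x ∈ a, τ x ∈ a) {x e : 𝔤} (hx : x ∈ 𝔢)
    (hxa : x ∈ a) (hx0 : x ≠ 0) (he : e ∈ 𝔢) (hea : e ∉ a) :
    (∀ w ∈ 𝔢, ∃ s t : ℂ, w = s • e + t • x) ∧ (∀ w ∈ 𝔣, ∃ s t : ℂ, w = s • τ e + t • τ x) ∧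
      ⁅e, τ x⁆ ∉ 𝔢.toSubmodule ⊔ 𝔣.toSubmodule ∧
      ∃ B : Module.Basis (Fin 5) ℂ 𝔤, ⇑B = ![e, x, τ e, τ x, ⁅e, τ x⁆] ∧
        LinearIndependent ℂ ![x, τ x, ⁅e, τ x⁆] ∧
        ∀ w ∈ a, ∃ p q r : ℂ, w = p • x + q • τ x + r • ⁅e, τ x⁆ := by
  have hspan : ∀ w ∈ 𝔢, ∃ s t : ℂ, w = s • e + t • x := fun w hw => by
    obtain ⟨s, t, h⟩ := Submodule.exists_eq_smul_add_smul (S := 𝔢.toSubmodule)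
      h.finrank_left hx hxa hx0 he hea hw
    exact ⟨t, s, by rw [h, add_comm]⟩
  have hspan' : ∀ w ∈ 𝔣, ∃ s t : ℂ, w = s • τ e + t • τ x := fun w hw => by
    obtain ⟨s, t, h⟩ := hspan _ (hτ.apply_mem_left hw)
    exact ⟨starRingEnd ℂ s, starRingEnd ℂ t, by
      rw [← hτ.involutive w, h, map_add, map_smulₛₗ, map_smulₛₗ]⟩
  -- Applying `τ` would put `⁅x, τ e⁆` in `C` as well; as `⁅x, τ x⁆ = 0`, this contradicts
  -- non-degeneracy.
  have hz : ⁅e, τ x⁆ ∉ 𝔢.toSubmodule ⊔ 𝔣.toSubmodule := by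
    intro hz
    have h1 := hτ.apply_mem_sup hz
    rw [hτ.map_lie, hτ.involutive x, ← lie_skew] at h1
    refine h.lie_notMem_sup hx hx0 hspan' ?_ (neg_mem_iff.1 h1)
    rw [haa x hxa _ (hτa x hxa)]
    exact zero_mem _
  obtain ⟨B, hB⟩ := h.exists_basis hspan hspan' hz
  have := h.finiteDimensional
  have hya := hτa x hxa
  have hza := ha e _ hya
  have hli : LinearIndependent ℂ ![x, τ x, ⁅e, τ x⁆] := by
    have h1 := B.linearIndependent.comp ![1, 3, 4] (by decide)
    rw [hB] at h1
    convert h1 using 1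
    ext i
    fin_cases i <;> rfl
  have hspana : ∀ w ∈ a, ∃ p q r : ℂ, w = p • x + q • τ x + r • ⁅e, τ x⁆ := by
    have hle : Submodule.span ℂ (Set.range ![x, τ x, ⁅e, τ x⁆]) ≤ a := by
      rw [Submodule.span_le]
      rintro _ ⟨i, rfl⟩
      fin_cases i <;> assumption
    have heq := Submodule.eq_of_le_of_finrank_eq hle (by
      rw [finrank_span_eq_card hli, hdim, Fintype.card_fin])
    intro w hw
    rw [← heq, Submodule.mem_span_range_iff_exists_fun] at hw
    obtain ⟨c, hc⟩ := hw
    exact ⟨c 0, c 1, c 2, by rw [← hc, Fin.sum_univ_three]; rfl⟩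
  exact ⟨hspan, hspan', hz, B, hB, hli, hspana⟩

/-- With `z = ⁅e, τ x⁆`, the involution determines `⁅τ e, x⁆ = τ z`. After a rescaling of `x` the
constants satisfy `c₂ = -conj c₁` and `u = -conj v`, so `v * c₁ = u * c₂` is trivial for `v = 0` and
says that `c₁` is real for `v = 1`. -/
theorem hasTwistedDerivation_of_lie_eq_smul_add (h : IsILCTriple 𝔢 𝔣)
    (hτ : IsAdmissibleAntiInvolution 𝔢 𝔣 τ) {a : Submodule ℂ 𝔤}
    (ha : ∀ x : 𝔤, ∀ y ∈ a, ⁅x, y⁆ ∈ a) (haa : ∀ x ∈ a, ∀ y ∈ a, ⁅x, y⁆ = 0)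
    (hdim : Module.finrank ℂ a = 3) (hτa : ∀ x ∈ a, τ x ∈ a) {x e : 𝔤} (hx : x ∈ 𝔢) (hxa : x ∈ a)
    (hx0 : x ≠ 0) (he : e ∈ 𝔢) (hea : e ∉ a) {v : ℂ} (hv : v = 0 ∨ v = 1) {w : 𝔤} (hw : w ∈ a)
    (hef : ⁅e, τ e⁆ = (-starRingEnd ℂ v) • e + v • τ e + w) : HasTwistedDerivation 𝔢 𝔣 := by
  obtain ⟨hspan, hspan', hzC, -, -, hli, hspana⟩ :=
    h.exists_adapted_basis hτ ha haa hdim hτa hx hxa hx0 he hea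
  have hya := hτa x hxa
  have hza := ha e _ hya
  obtain ⟨α, hex⟩ := Submodule.exists_eq_smul_of_mem_inf (S := 𝔢.toSubmodule) h.finrank_left hx
    hxa hx0 he hea (𝔢.lie_mem he hx) (ha e x hxa)
  have hfy : ⁅τ e, τ x⁆ = starRingEnd ℂ α • τ x := by rw [← hτ.map_lie, hex, map_smulₛₗ]
  obtain ⟨c₁, c₂, ε, hε⟩ := hspana _ (hτa _ hza)
  have hfx : ⁅τ e, x⁆ = c₁ • x + c₂ • τ x + ε • ⁅e, τ x⁆ := by
    rw [← hε, hτ.map_lie, hτ.involutive x]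
  have hττ := hτ.involutive ⁅e, τ x⁆
  rw [hε, map_add, map_add, map_smulₛₗ, map_smulₛₗ, map_smulₛₗ, hτ.involutive x, hε,
    ← sub_eq_zero] at hττ
  have hcoef := Fintype.linearIndependent_iff.1 hli
    ![starRingEnd ℂ c₂ + starRingEnd ℂ ε * c₁, starRingEnd ℂ c₁ + starRingEnd ℂ ε * c₂,
      starRingEnd ℂ ε * ε - 1] (by
        rw [← hττ, Fin.sum_univ_three]
        simp only [Matrix.cons_val]
        module)
  have hε1 : starRingEnd ℂ ε * ε - 1 = 0 := hcoef 2
  have hc : starRingEnd ℂ c₁ + starRingEnd ℂ ε * c₂ = 0 := hcoef 1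
  have hε0 : starRingEnd ℂ ε ≠ 0 := by
    intro h0
    simp [h0] at hε1
  -- From `τ² = id` one gets `|ε| = 1`, so this unit makes the `z`-coefficient of `⁅τ e, x'⁆` equal
  -- to `1`. The vector `τ x` is deliberately not rescaled, which keeps `⁅e, τ x⁆ = z`.
  set x' := starRingEnd ℂ ε • x with hx'
  have hxx' : x = ε • x' := by
    rw [hx', smul_smul, mul_comm, sub_eq_zero.1 hε1, one_smul]
  have hx'a : x' ∈ a := a.smul_mem _ hxa
  have hex' : ⁅e, x'⁆ = α • x' := by rw [hx', lie_smul, hex, smul_comm]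
  have hfx' : ⁅τ e, x'⁆ = ⁅e, τ x⁆ + c₁ • x' + (-starRingEnd ℂ c₁) • τ x := by
    rw [eq_neg_of_add_eq_zero_left hc, neg_neg, hx', lie_smul, hfx]
    rw [smul_add, smul_add, smul_smul, smul_smul, smul_smul, smul_smul, sub_eq_zero.1 hε1,
      mul_comm c₁]
    module
  refine h.hasTwistedDerivation_of_lie_eq haa (𝔢.smul_mem _ hx) (hτ.apply_mem_right hx) hx'a hya
    hza (smul_ne_zero hε0 hx0) ?_ hspan' hzC ?_ (ha _ _ hza) (ha _ _ hza) hw hex' rfl hfy hfx' hef ?_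
  · intro w hw
    obtain ⟨s, t, h1⟩ := hspan w hw
    exact ⟨s, t * ε, by rw [h1, mul_smul, ← hxx']⟩
  · intro w hw
    obtain ⟨p, q, r, h1⟩ := hspana w hw
    exact ⟨p * ε, q, r, by rw [h1, mul_smul, ← hxx']⟩
  · rcases hv with rfl | rfl
    · simp
    · have hli' : LinearIndependent ℂ ![x', τ x, ⁅e, τ x⁆] := by
        have h1 := hli.units_smul ![Units.mk0 _ hε0, 1, 1]
        convert h1 using 1
        ext i
        fin_cases i <;> simp [hx', Units.smul_def]
      have hreal := conj_eq_of_lie_eq hli' (haa _ hw _ hx'a) (haa _ hw _ hya) (haa _ hw _ hza)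
        hex' rfl hfy hfx' (by rw [hef]; simp)
      rw [hreal]
      simp

/-- By dimension `𝔢` is not contained in `a`, so `x` extends by some `e ∉ a` to a basis of `𝔢`; only
`⁅e, τ e⁆` modulo `a` needs normalising. -/
theorem hasTwistedDerivation_of_mem_ideal (h : IsILCTriple 𝔢 𝔣)
    (hτ : IsAdmissibleAntiInvolution 𝔢 𝔣 τ) {a : Submodule ℂ 𝔤}
    (ha : ∀ x : 𝔤, ∀ y ∈ a, ⁅x, y⁆ ∈ a) (haa : ∀ x ∈ a, ∀ y ∈ a, ⁅x, y⁆ = 0)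
    (hdim : Module.finrank ℂ a = 3) (hτa : ∀ x ∈ a, τ x ∈ a) {x : 𝔤} (hx : x ∈ 𝔢) (hxa : x ∈ a)
    (hx0 : x ≠ 0) : HasTwistedDerivation 𝔢 𝔣 := by
  have := h.finiteDimensional
  obtain ⟨e, he, hea⟩ : ∃ e ∈ 𝔢, e ∉ a := by
    by_contra! hall
    have hle : 𝔢.toSubmodule ⊔ 𝔣.toSubmodule ≤ a := sup_le hall fun y hy => by
      have h1 := hτa _ (hall _ (hτ.apply_mem_left hy))
      rwa [hτ.involutive y] at h1
    have h1 := Submodule.finrank_mono hle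
    rw [h.finrank_sup, hdim] at h1
    omega
  obtain ⟨-, -, -, B, hB, -, hspana⟩ :=
    h.exists_adapted_basis hτ ha haa hdim hτa hx hxa hx0 he hea
  have hya := hτa x hxa
  have hza := ha e _ hya
  have hsum := B.sum_repr ⁅e, τ e⁆
  rw [hB] at hsum
  simp only [Fin.sum_univ_five] at hsum
  set c := B.repr ⁅e, τ e⁆
  set w := c 1 • x + c 3 • τ x + c 4 • ⁅e, τ x⁆ with hwdef
  have hw : w ∈ a := add_mem (add_mem (a.smul_mem _ hxa) (a.smul_mem _ hya)) (a.smul_mem _ hza)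
  have hef : ⁅e, τ e⁆ = c 0 • e + c 2 • τ e + w := by
    rw [← hsum, hwdef]
    simp only [Matrix.cons_val]
    abel
  -- `τ` sends `⁅e, τ e⁆` to its negative; compare coefficients of `e`.
  have huv : c 0 = -starRingEnd ℂ (c 2) := by
    have hneg : τ ⁅e, τ e⁆ = -⁅e, τ e⁆ := by rw [hτ.map_lie, hτ.involutive e, lie_skew]
    rw [hef, map_add, map_add, map_smulₛₗ, map_smulₛₗ, hτ.involutive e] at hneg
    obtain ⟨p, q, r, hpqr⟩ := hspana _ (neg_mem (add_mem hw (hτa w hw)))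
    have hcomb : (c 0 + starRingEnd ℂ (c 2)) • e + (c 2 + starRingEnd ℂ (c 0)) • τ e
        = p • x + q • τ x + r • ⁅e, τ x⁆ := by
      rw [← hpqr, ← sub_eq_zero]
      rw [← sub_eq_zero] at hneg
      rw [← hneg]; module
    have hcoef := Fintype.linearIndependent_iff.1 (hB ▸ B.linearIndependent)
      ![c 0 + starRingEnd ℂ (c 2), -p, c 2 + starRingEnd ℂ (c 0), -q, -r] (by
        rw [Fin.sum_univ_five]
        simp only [Matrix.cons_val]
        rw [← sub_eq_zero] at hcomb
        rw [← hcomb]; module)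
    exact eq_neg_of_add_eq_zero_left (hcoef 0)
  by_cases hv : c 2 = 0
  · exact h.hasTwistedDerivation_of_lie_eq_smul_add hτ ha haa hdim hτa hx hxa hx0 he hea (Or.inl hv)
      hw (huv ▸ hef)
  · have hv' : starRingEnd ℂ (c 2) ≠ 0 := by simpa using hv
    -- Replacing `e` by `(c 2)⁻¹ • e` divides the bracket by `c 2 * conj (c 2)`, which turns the
    -- coefficients `-conj (c 2)` and `c 2` into `-1` and `1`.
    refine h.hasTwistedDerivation_of_lie_eq_smul_add hτ ha haa hdim hτa hx hxa hx0
      (𝔢.smul_mem (c 2)⁻¹ he) (fun h1 => hea ((a.smul_mem_iff (inv_ne_zero hv)).1 h1)) (Or.inr rfl)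
      (a.smul_mem ((c 2)⁻¹ * (starRingEnd ℂ (c 2))⁻¹) hw) ?_
    rw [map_smulₛₗ, smul_lie, lie_smul, hef, huv, map_inv₀, map_one]
    match_scalars <;> field_simp

end IsILCTriple

end InvariantIdeal

theorem theorem4p1
    {𝔤 : Type*} [LieRing 𝔤] [LieAlgebra ℂ 𝔤]
    (𝔢 𝔣 : LieSubalgebra ℂ 𝔤) (h𝔢𝔣 : IsILCTriple 𝔢 𝔣)
    (τ : 𝔤 →ₛₗ[starRingEnd ℂ] 𝔤) (hτ : IsAdmissibleAntiInvolution 𝔢 𝔣 τ)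
    (𝔞 : LieIdeal ℂ 𝔤) (h𝔞 : Module.finrank ℂ 𝔞 = 3) (h𝔞_abelian : IsLieAbelian 𝔞)
    {E : Type*} [NormedAddCommGroup E] [NormedSpace ℂ E] [CompleteSpace E]
    {G : Type*} [TopologicalSpace G] [ChartedSpace E G] [Group G] [LieGroup 𝓘(ℂ, E) ω G]
    (ι : 𝔤 ≃ₗ⁅ℂ⁆ GroupLieAlgebra 𝓘(ℂ, E) G)
    (hdim : ilcSymDim ι 𝔢 𝔣 = 5) :
    𝔞.toSubmodule.map τ = 𝔞.toSubmodule ∧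
      𝔢.toSubmodule ⊓ 𝔞.toSubmodule = ⊥ ∧ 𝔣.toSubmodule ⊓ 𝔞.toSubmodule = ⊥ := by
  have := h𝔢𝔣.finiteDimensional
  have hid : ∀ x : 𝔤, ∀ y ∈ 𝔞.toSubmodule, ⁅x, y⁆ ∈ 𝔞.toSubmodule := fun x y hy =>
    lie_mem_right ℂ 𝔤 𝔞 x y hy
  have hab : ∀ x ∈ 𝔞.toSubmodule, ∀ y ∈ 𝔞.toSubmodule, ⁅x, y⁆ = 0 := fun x hx y hy =>
    congrArg Subtype.val (h𝔞_abelian.trivial ⟨x, hx⟩ ⟨y, hy⟩)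
  have hsolv : LieAlgebra.IsSolvable 𝔤 :=
    LieAlgebra.isSolvable_of_codim_two 𝔞 hab (by rw [h𝔢𝔣.finrank_eq, h𝔞])
  have hnone : ¬ HasTwistedDerivation 𝔢 𝔣 := by
    rintro ⟨D, φ, hD, hD0, hDe, hDf⟩
    have h6 := six_le_ilcSymDim h𝔢𝔣.finrank_eq ι 𝔢 𝔣 hD hD0 hDe hDf
    rw [hdim] at h6
    exact absurd h6 (by norm_num)
  have hmap : 𝔞.toSubmodule.map τ = 𝔞.toSubmodule := by
    by_contra hne
    exact hnone (h𝔢𝔣.hasTwistedDerivation_of_map_ne hτ hid hab h𝔞 hne)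
  have hτ𝔞 : ∀ x ∈ 𝔞.toSubmodule, τ x ∈ 𝔞.toSubmodule := fun x hx =>
    hτ.mem_map_iff.1 (hmap.symm ▸ hx)
  have hleft : ∀ x ∈ 𝔢, x ∈ 𝔞.toSubmodule → x = 0 := fun x hx hxa => by
    by_contra hx0
    exact hnone (h𝔢𝔣.hasTwistedDerivation_of_mem_ideal hτ hid hab h𝔞 hτ𝔞 hx hxa hx0)
  refine ⟨hmap, (Submodule.eq_bot_iff _).2 fun x hx => hleft x hx.1 hx.2,
    (Submodule.eq_bot_iff _).2 fun x hx => ?_⟩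
  rw [← hτ.involutive x, hleft _ (hτ.apply_mem_left hx.1) (hτ𝔞 x hx.2), map_zero]
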